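/- Let $r\ge 2$, $I=\{1,\dots,r\}$. Consider multigerms $\varphi=[\varphi_1,\dots,\varphi_r]$ of plane curves with $r$ branches in Puiseux form $$\varphi_i(t_i)=\Bigl(t_i^2,\ \sum_{j\ge 3}a_{ij}t_i^j\Bigr),\qquad i\in I,$$ with convergent series, whose value semiring $\Gamma=\{(\nu_1(h),\dots,\nu_r(h)) : h\in\mathbb{C}\{X,Y\}\}\subset(\mathbb{N}\cup\{\infty\})^r$, where $\nu_i(h)$ is the order in $t_i$ of $\varphi_i^*(h)=h\circ\varphi_i$, is the semiring (for the operations $\inf$ and $+$) generated by $v_1=(2,\dots,2)$, $v_2=(3,\dots,3)$ and $v_{i+2}=(6,\dots,6,\infty,6,\dots,6)$ with $\infty$ in the $i$-th place, $i\in I$. For $\omega=p\,dX+q\,dY$ with $p,q\in\mathbb{C}\{X,Y\}$ put $\varphi_i^*(\omega)=t_i\bigl(\varphi_i^*(p)\,x_i'+\varphi_i^*(q)\,y_i'\bigr)$, where $\varphi_i=(x_i,y_i)$, and let $$\mathcal{I}=\Bigl\{\Bigl(\tfrac{\varphi_1^*(\omega)}{2t_1^2},\dots,\tfrac{\varphi_r^*(\omega)}{2t_r^2}\Bigr)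 : \omega=\eta_2\,dX-\eta_1\,dY,\ \eta_1\in\langle X^2,Y\rangle,\ \eta_2\in\langle X,Y\rangle^2\Bigr\}.$$ For $k>3$ let $e(k)$ be the largest integer $e\le r$ such that for all $b_1,\dots,b_e\in\mathbb{C}$ there are $b_{e+1},\dots,b_r\in\mathbb{C}$ and $\mathrm{w}\in\mathcal{I}$ with $k$-jet $j^k\mathrm{w}=(b_1t_1^k,\dots,b_rt_r^k)$. Let $\Lambda=\{(\operatorname{ord}\mathrm{w}_1,\dots,\operatorname{ord}\mathrm{w}_r) : \mathrm{w}\in\mathcal{I}\}$ and, for $J\subseteq I$, let $F_J(k)$ be the set of $\delta\in\Lambda$ with $\delta_j=k$ for $j\in J$ and $\delta_i>k$ for $i\notin J$. Let $L_k$ be the subset of $I$ whose indicator vector is the largest, in the graded lexicographic order, among the sets $L\subseteq I$ such that for each $l\in L$ there is $J_l\subseteq I$ with $l\in J_l\setminus\bigcup_{i\in L\setminus\{l\}}J_i$ and $F_{J_l}(k)\ne\emptyset$. **Proposition 6.6.** If the coefficients $a_{ij}$ of $\varphi$ are generic, then $L_k=\{1,\dots,e(k)\}$ for every $k>3$, and: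 1. $e(4)=2$ and $e(5)=1$; 2. if $r$ is even and $r\ge 4$, then $e\bigl(6\bigl[\tfrac{r-2}{2}\bigr]+5\bigr)=e(3r-1)=r$; 3. for every other $k\ge 6$ (that is, every $k\ge6$ if $r$ is odd, and every $k\ge 6$ with $k\ne 3r-1$ if $r$ is even), $$e(k)=\min\bigl\{2\bigl[\tfrac k6\bigr]+1,\ r\bigr\}\ \text{ if } k\not\equiv 4 \bmod 6,\qquad e(k)=\min\bigl\{2\bigl[\tfrac k6\bigr]+3,\ r\bigr\}\ \text{ if } k\equiv 4\bmod 6.$$ Here "generic" means: for each $r$ there is a nonzero polynomial $P$ in finitely many of the coefficients $a_{ij}$ ($i\in I$, $j\ge3$), depending only on $r$, such that all the conclusions (for all $k$ at once) hold for every $\varphi$ as above with $P(a_{ij})\ne0$. -/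

import Mathlib

open scoped PowerSeries

noncomputable section

/-- The ring of convergent complex power series in the variables `σ`: those which converge
absolutely at all points of some polydisc of positive radius around the origin.
`ConvergentSeries (Fin 2)` is `ℂ{X, Y}` and `ConvergentSeries Unit` is `ℂ{t}`. -/
def ConvergentSeries (σ : Type) : Subalgebra ℂ (MvPowerSeries σ ℂ) where
  carrier := {f | ∃ ρ : ℝ, 0 < ρ ∧
    Summable fun d : σ →₀ ℕ => ‖MvPowerSeries.coeff d f‖ * ρ ^ d.degree}
  mul_mem' := by
    classical
    rintro f g ⟨ρ, hρ, hf⟩ ⟨τ, hτ, hg⟩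
    have mono : ∀ (h : MvPowerSeries σ ℂ) (a b : ℝ), 0 < a → a ≤ b →
        (Summable fun d : σ →₀ ℕ => ‖MvPowerSeries.coeff d h‖ * b ^ d.degree) →
        Summable fun d : σ →₀ ℕ => ‖MvPowerSeries.coeff d h‖ * a ^ d.degree := by
      intro h a b ha hab hs
      refine hs.of_nonneg_of_le (fun d => by positivity) (fun d => ?_)
      gcongr
    have hm : 0 < min ρ τ := lt_min hρ hτ
    refine ⟨min ρ τ, hm, ?_⟩
    have h1 := mono f _ _ hm (min_le_left ρ τ) hf
    have h2 := mono g _ _ hm (min_le_right ρ τ) hg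
    have h3 := summable_sum_mul_antidiagonal_of_summable_mul
      (Summable.mul_of_nonneg h1 h2 (fun d => by positivity) (fun d => by positivity))
    refine h3.of_nonneg_of_le (fun d => by positivity) (fun d => ?_)
    rw [MvPowerSeries.coeff_mul]
    calc _ ≤ (∑ p ∈ Finset.HasAntidiagonal.antidiagonal d,
          ‖MvPowerSeries.coeff p.1 f * MvPowerSeries.coeff p.2 g‖) * min ρ τ ^ d.degree := by
          gcongr
          exact norm_sum_le _ _
      _ = _ := by
          rw [Finset.sum_mul]
          refine Finset.sum_congr rfl fun p hp => ?_
          rw [← Finset.HasAntidiagonal.mem_antidiagonal.mp hp, map_add, pow_add, norm_mul]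
          ring
  add_mem' := by
    rintro f g ⟨ρ, hρ, hf⟩ ⟨τ, hτ, hg⟩
    have hm : 0 < min ρ τ := lt_min hρ hτ
    refine ⟨min ρ τ, hm, (hf.add hg).of_nonneg_of_le (fun d => by positivity) (fun d => ?_)⟩
    calc _ ≤ (‖MvPowerSeries.coeff d f‖ + ‖MvPowerSeries.coeff d g‖) * min ρ τ ^ d.degree := by
          gcongr
          rw [map_add]
          exact norm_add_le _ _
      _ ≤ _ := by
          rw [add_mul]
          gcongr
          · exact min_le_left _ _
          · exact min_le_right _ _
  algebraMap_mem' := by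
    classical
    intro c
    refine ⟨1, one_pos, summable_of_ne_finset_zero (s := {0}) fun d hd => ?_⟩
    have : d ≠ 0 := by simpa using hd
    simp [MvPowerSeries.algebraMap_apply, MvPowerSeries.coeff_C, this]

theorem ConvergentSeries.X_mem {σ : Type} (s : σ) :
    (MvPowerSeries.X s : MvPowerSeries σ ℂ) ∈ ConvergentSeries σ := by
  classical
  refine ⟨1, one_pos, summable_of_ne_finset_zero (s := {Finsupp.single s 1}) fun d hd => ?_⟩
  have : d ≠ Finsupp.single s 1 := by simpa using hd
  simp [MvPowerSeries.coeff_X, this]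

namespace PlaneCurve

/-- The coordinate `X` of `ℂ{X, Y}`. -/
def coordX : ConvergentSeries (Fin 2) := ⟨MvPowerSeries.X 0, ConvergentSeries.X_mem 0⟩

/-- The coordinate `Y` of `ℂ{X, Y}`. -/
def coordY : ConvergentSeries (Fin 2) := ⟨MvPowerSeries.X 1, ConvergentSeries.X_mem 1⟩

/-- A multigerm `φ = [φ₁, …, φ_r]` of convergent parametrizations
`φ_i = (x_i, y_i) : (ℂ, 0) → (ℂ², 0)`. -/
structure Multigerm (r : ℕ) where
  x : Fin r → ℂ⟦X⟧
  y : Fin r → ℂ⟦X⟧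
  x_conv : ∀ i, x i ∈ ConvergentSeries Unit
  y_conv : ∀ i, y i ∈ ConvergentSeries Unit
  x_zero : ∀ i, PowerSeries.constantCoeff (x i) = 0
  y_zero : ∀ i, PowerSeries.constantCoeff (y i) = 0

namespace Multigerm

variable {r : ℕ}

/-- `φ_i^*(h) = h(x_i, y_i)` for `h ∈ ℂ{X, Y}`. -/
def pullback (φ : Multigerm r) (i : Fin r) (h : ConvergentSeries (Fin 2)) : ℂ⟦X⟧ :=
  MvPowerSeries.subst ![φ.x i, φ.y i] (h : MvPowerSeries (Fin 2) ℂ)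

/-- `φ_i^*(a dX + b dY) = t_i (φ_i^*(a) x_i' + φ_i^*(b) y_i')`. -/
def pullbackForm (φ : Multigerm r) (i : Fin r) (a b : ConvergentSeries (Fin 2)) : ℂ⟦X⟧ :=
  PowerSeries.X * (φ.pullback i a * PowerSeries.derivative ℂ (φ.x i) +
    φ.pullback i b * PowerSeries.derivative ℂ (φ.y i))

/-- The value semiring `Γ = {(ν₁(h), …, ν_r(h)) : h ∈ ℂ{X, Y}}`, with `ν_i(h)` the order of
`φ_i^*(h)`. -/
def valueSemiring (φ : Multigerm r) : Set (Fin r → ℕ∞) :=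
  {γ | ∃ h : ConvergentSeries (Fin 2), γ = fun i => (φ.pullback i h).order}

/-- The multiplicity `n_i` of the `i`-th branch. -/
def mult (φ : Multigerm r) (i : Fin r) : ℕ :=
  (min (φ.x i).order (φ.y i).order).toNat

/-- Puiseux block form with one block and exponents `n, m`: the `i`-th branch is
`(t^n, ∑_{j ≥ m} a_{ij} t^j)`. -/
def IsPuiseuxBlock (φ : Multigerm r) (n m : ℕ) : Prop :=
  ∀ i, φ.x i = PowerSeries.X ^ n ∧ ∀ j < m, PowerSeries.coeff j (φ.y i) = 0

/-- The vector of the coefficients `a_{ij}`, `j ≥ m`, of the series `y_i`; the entry with index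
`(i, j)` is `a_{i, m + j}`. -/
def coeffVector (φ : Multigerm r) (m : ℕ) : Fin r × ℕ → ℂ :=
  fun q => PowerSeries.coeff (m + q.2) (φ.y q.1)

/-- The fractional ideal `𝓘_𝓖` for the group `𝓖 = 𝓐̃₁` of the one block case: all
`w = (φ_i^*(ω) / (n_i t_i^{n_i}))_i`, where `ω = η₂ dX - η₁ dY` with `η₁ ∈ ⟨X², Y⟩` and
`η₂ ∈ ⟨X, Y⟩²`. For a multigerm in Puiseux block form with one block these quotients are power
series. -/
def idealI (φ : Multigerm r) : Set (Fin r → ℂ⟦X⟧) :=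
  {w | ∃ η₁ ∈ (Ideal.span {coordX ^ 2, coordY} : Ideal (ConvergentSeries (Fin 2))),
    ∃ η₂ ∈ (Ideal.span {coordX, coordY} : Ideal (ConvergentSeries (Fin 2))) ^ 2,
    ∀ i, (φ.mult i : ℂ⟦X⟧) * PowerSeries.X ^ φ.mult i * w i = φ.pullbackForm i η₂ (-η₁)}

/-- `e(k)`: the largest `e ≤ r` such that for all `b₁, …, b_e ∈ ℂ` there is `w ∈ 𝓘_𝓖` with
`j^k(w) = (b₁ t₁^k, …, b_r t_r^k)` for some values of the remaining `b_{e+1}, …, b_r`. -/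
def e (φ : Multigerm r) (k : ℕ) : ℕ :=
  sSup {e | e ≤ r ∧ ∀ b : Fin r → ℂ, ∃ c : Fin r → ℂ, (∀ i : Fin r, i.val < e → c i = b i) ∧
    ∃ w ∈ φ.idealI, ∀ i, PowerSeries.trunc (k + 1) (w i) = Polynomial.monomial k (c i)}

/-- `Λ_𝓖 = {ν(w) : w ∈ 𝓘_𝓖}`. -/
def lambdaSet (φ : Multigerm r) : Set (Fin r → ℕ∞) :=
  {γ | ∃ w ∈ φ.idealI, γ = fun i => (w i).order}

/-- The `J`-fiber `F_J(k, …, k)` with respect to `Λ_𝓖`. -/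
def fiber (φ : Multigerm r) (J : Finset (Fin r)) (k : ℕ) : Set (Fin r → ℕ∞) :=
  {δ | δ ∈ φ.lambdaSet ∧ (∀ j ∈ J, δ j = k) ∧ ∀ i ∉ J, (k : ℕ∞) < δ i}

/-- Condition `(⋆)` on a set `L` of branches: for each `l ∈ L` there is `J_l` with
`l ∈ J_l \ ⋃_{i ∈ L \ {l}} J_i` and `F_{J_l}(k, …, k) ≠ ∅`. -/
def Star (φ : Multigerm r) (k : ℕ) (L : Finset (Fin r)) : Prop :=
  ∃ J : Fin r → Finset (Fin r), ∀ l ∈ L,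
    l ∈ J l ∧ (∀ i ∈ L, i ≠ l → l ∉ J i) ∧ (φ.fiber (J l) k).Nonempty

/-- The key of `L` for the graded lexicographic order: its cardinality, then its indicator
vector. -/
def gradedKey (L : Finset (Fin r)) : ℕ ×ₗ Lex (Fin r → ℕ) :=
  toLex (L.card, toLex fun i => if i ∈ L then 1 else 0)

/-- `L` is the set `L_k`: the maximum, for the graded lexicographic order, of the sets
satisfying `(⋆)`. -/
def IsL (φ : Multigerm r) (k : ℕ) (L : Finset (Fin r)) : Prop :=
  φ.Star k L ∧ ∀ L' : Finset (Fin r), φ.Star k L' → gradedKey L' ≤ gradedKey L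

end Multigerm

/-- The elements `v₁ = (n, …, n)`, `v₂ = (m, …, m)` and `v_{i+2} = (nm, …, ∞, …, nm)`, with `∞` at
place `i`. -/
def gens (n m r : ℕ) : Fin 2 ⊕ Fin r → (Fin r → ℕ∞) :=
  Sum.elim ![fun _ => (n : ℕ∞), fun _ => (m : ℕ∞)]
    (fun i => Function.update (fun _ => (n : ℕ∞) * m) i ⊤)

/-- The semiring generated by a finite family `v` of elements of `(ℕ ∪ {∞})^r` for the operations
`inf` and `+`: all infima of `r` sums `∑_j a_{kj} v_j` with `a_{kj} ∈ ℕ`. -/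
def semiringSpan {r : ℕ} {ι : Type} [Fintype ι] (v : ι → (Fin r → ℕ∞)) : Set (Fin r → ℕ∞) :=
  {γ | ∃ a : Fin r → ι → ℕ, γ = ⨅ k : Fin r, ∑ j, a k j • v j}

end PlaneCurve

end

/-! On a branch (t², y), y = a₃t³ + a₄t⁴ + …, dividing the pullback of ω by 2t² leaves w = η₂ − η₁
dy/dx. Give X weight 2 and Y weight 3. Up to any prescribed order the ideal is spanned by "columns":
the monomials X^a Y^b with a + b ≥ 2; the products (2/3) Y^(b-1) dy/dx with b ≥ 2, which behave like
X⁻¹Y^b; and the products X^a Y^b D with a + b ≥ 1, where D = 2x dy/dx − 3y has lost its t³ term. A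
column of weight n starts at t^n with coefficient a₃^b or a₄ a₃^b, and b ≡ n mod 2 throughout
(`coeff_col_inl`, `coeff_col_inr`).

Let N(n) be the number of columns of weight n. It is 2[n/6] + 1, or 2[n/6] + 3 if n ≡ 4 mod 6,
except that N(4) = 2 because D itself is not allowed. For generic a₃, a₄ the leading vectors in ℂ^r
are as independent as r permits, by Vandermonde determinants in a₃² (`leadPoly_ne_zero`). If N(n) ≤
r for all n < k, no combination cancels below t^k except trivially, so the vectors of
t^k-coefficients of elements of order at least k (`jetSpace`) are exactly the span of the leading
vectors of weight k. If N(k) ≥ r, they fill ℂ^r in any case. Once this space has dimension at most d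
and projects onto the first d coordinates, both e(k) = d and L_k = {1, …, d} follow by linear
algebra (`e_eq`, `isL_filter`).

The remaining case is N(k) < r < N(n) for some n < k. Since N drops only from 6m+4 to 6m+5, this
means r = 2m+2 and k = 6m+5 = 3r−1 with m ≥ 1 (`numF_add_numG_le`). The r+1 columns of weight k−1
then satisfy a relation, which supplies one more vector at t^k besides the r−1 columns of weight k.
That it is generically new is the nonvanishing of a 2r × 2r determinant in the coefficients of
t^(k-1) and t^k (`twoPoly_ne_zero`). -/

noncomputable section

namespace PlaneCurve

/-! ### Columns and their leading coefficients -/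

section Columns

variable {A B : Type*} [CommRing A] [Algebra ℂ A] [CommRing B] [Algebra ℂ B]

/-- The series `dy/dx = y' / (2t)` along the branch `(t², y)`. -/
def slope (y : A⟦X⟧) : A⟦X⟧ :=
  PowerSeries.mk fun n => algebraMap ℂ A ((n + 2) / 2) * PowerSeries.coeff (n + 2) y

/-- The series `2 x dy/dx - 3 y`, which vanishes along the curves `(t², a t³)`. -/
def defect (y : A⟦X⟧) : A⟦X⟧ := 2 * PowerSeries.X ^ 2 * slope y - 3 * y

/-- The power of `Y` in the `j`-th monomial of weight `n`. -/
def yExp (n j : ℕ) : ℕ := n % 2 + 2 * j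

/-- The `j`-th monomial of weight `n` on the branch `(t², y)`; the monomial
`X⁻¹ Y ^ b` is replaced by `(2/3) Y ^ (b - 1) dy/dx`. -/
def monoF (y : A⟦X⟧) (n j : ℕ) : A⟦X⟧ :=
  if 3 * yExp n j ≤ n then PowerSeries.X ^ (n - 3 * yExp n j) * y ^ yExp n j
  else PowerSeries.C (algebraMap ℂ A (2 / 3)) * (y ^ (yExp n j - 1) * slope y)

/-- The `j`-th monomial of weight `n - 4` times `defect`. -/
def monoG (y : A⟦X⟧) (n j : ℕ) : A⟦X⟧ :=
  PowerSeries.X ^ (n - 4 - 3 * yExp n j) * y ^ yExp n j * defect y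

/-- The number of columns `monoF` of weight `n`. -/
def numF (n : ℕ) : ℕ := if n < 4 then 0 else (n + 2 - 3 * (n % 2)) / 6 + 1

/-- The number of columns `monoG` of weight `n`. -/
def numG (n : ℕ) : ℕ := if n < 5 then 0 else (n + 2 - 3 * (n % 2)) / 6

/-- All columns of weight `n`. -/
def col (y : A⟦X⟧) (n : ℕ) : Fin (numF n) ⊕ Fin (numG n) → A⟦X⟧ :=
  Sum.elim (fun j => monoF y n j) (fun j => monoG y n j)

theorem map_slope (f : A →ₐ[ℂ] B) (y : A⟦X⟧) :
    PowerSeries.map (f : A →+* B) (slope y) = slope (PowerSeries.map (f : A →+* B) y) := by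
  ext n
  simp [slope]

theorem map_defect (f : A →ₐ[ℂ] B) (y : A⟦X⟧) :
    PowerSeries.map (f : A →+* B) (defect y) = defect (PowerSeries.map (f : A →+* B) y) := by
  rw [defect, defect, ← map_slope]
  simp only [map_sub, map_mul, map_pow, PowerSeries.map_X]
  rw [map_ofNat, map_ofNat]

theorem map_monoF (f : A →ₐ[ℂ] B) (y : A⟦X⟧) (n j : ℕ) :
    PowerSeries.map (f : A →+* B) (monoF y n j) =
      monoF (PowerSeries.map (f : A →+* B) y) n j := by
  unfold monoF
  split_ifs <;> simp [← map_slope]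

theorem map_monoG (f : A →ₐ[ℂ] B) (y : A⟦X⟧) (n j : ℕ) :
    PowerSeries.map (f : A →+* B) (monoG y n j) =
      monoG (PowerSeries.map (f : A →+* B) y) n j := by
  simp [monoG, map_defect]

theorem map_col (f : A →ₐ[ℂ] B) (y : A⟦X⟧) (n : ℕ) (j) :
    PowerSeries.map (f : A →+* B) (col y n j) = col (PowerSeries.map (f : A →+* B) y) n j := by
  rcases j with j | j
  · exact map_monoF f y n j
  · exact map_monoG f y n j

theorem exists_eq_X_pow_mul {R : Type*} [CommRing R] {y : R⟦X⟧}
    (hy : ∀ j < 3, PowerSeries.coeff j y = 0) :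
    ∃ z, y = PowerSeries.X ^ 3 * z ∧ PowerSeries.constantCoeff z = PowerSeries.coeff 3 y := by
  obtain ⟨z, hz⟩ := PowerSeries.X_pow_dvd_iff.2 hy
  refine ⟨z, hz, ?_⟩
  conv_rhs => rw [hz, ← zero_add 3, PowerSeries.coeff_X_pow_mul]
  simp

theorem exists_slope_eq {y : A⟦X⟧} (hy : ∀ j < 3, PowerSeries.coeff j y = 0) :
    ∃ v, slope y = PowerSeries.X * v ∧
      PowerSeries.constantCoeff v = algebraMap ℂ A (3 / 2) * PowerSeries.coeff 3 y := by
  obtain ⟨v, hv⟩ : PowerSeries.X ∣ slope y := by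
    rw [PowerSeries.X_dvd_iff, ← PowerSeries.coeff_zero_eq_constantCoeff_apply]
    simp [slope, hy 2]
  refine ⟨v, hv, ?_⟩
  have : PowerSeries.coeff 1 (slope y) = PowerSeries.constantCoeff v := by
    rw [hv, ← zero_add 1, PowerSeries.coeff_succ_X_mul]
    simp
  rw [← this]
  simp only [slope, PowerSeries.coeff_mk]
  norm_num

/-- Since 2x dy/dx = t y', the defect is the Euler operator t d/dt minus 3, applied to y. -/
theorem coeff_defect {y : A⟦X⟧} (hy : ∀ j < 3, PowerSeries.coeff j y = 0) (n : ℕ) :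
    PowerSeries.coeff n (defect y) = ((n : A) - 3) * PowerSeries.coeff n y := by
  have h3 : (3 : A⟦X⟧) = PowerSeries.C 3 := (map_ofNat PowerSeries.C 3).symm
  have h2 : (2 : A⟦X⟧) = PowerSeries.C 2 := (map_ofNat PowerSeries.C 2).symm
  rw [defect, map_sub, h3, h2, mul_assoc, PowerSeries.coeff_C_mul, PowerSeries.coeff_C_mul]
  rcases lt_or_ge n 2 with hn | hn
  · rw [PowerSeries.coeff_X_pow_mul', if_neg (by omega), hy n (by omega)]
    simp
  · obtain ⟨m, rfl⟩ := Nat.exists_eq_add_of_le' hn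
    rw [PowerSeries.coeff_X_pow_mul, slope, PowerSeries.coeff_mk]
    have : (2 : A) * algebraMap ℂ A ((m + 2) / 2) = ((m + 2 : ℕ) : A) := by
      have h : (2 : A) = algebraMap ℂ A 2 := (map_ofNat (algebraMap ℂ A) 2).symm
      rw [h, ← map_mul, mul_div_cancel₀ _ two_ne_zero]
      simp
      exact map_ofNat _ 2
    rw [← mul_assoc, this]
    ring

theorem exists_defect_eq {y : A⟦X⟧} (hy : ∀ j < 3, PowerSeries.coeff j y = 0) :
    ∃ v, defect y = PowerSeries.X ^ 4 * v ∧
      PowerSeries.constantCoeff v = PowerSeries.coeff 4 y ∧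
      PowerSeries.coeff 1 v = 2 * PowerSeries.coeff 5 y := by
  obtain ⟨v, hv⟩ : PowerSeries.X ^ 4 ∣ defect y := by
    refine PowerSeries.X_pow_dvd_iff.2 fun m hm => ?_
    rw [coeff_defect hy]
    rcases Nat.lt_or_ge m 3 with h | h
    · simp [hy m h]
    · obtain rfl : m = 3 := by omega
      simp
  refine ⟨v, hv, ?_, ?_⟩
  · have := coeff_defect hy 4
    rw [hv, ← zero_add 4, PowerSeries.coeff_X_pow_mul] at this
    norm_num at this
    simpa using this
  · have := coeff_defect hy 5
    rw [hv, show 5 = 1 + 4 from rfl, PowerSeries.coeff_X_pow_mul] at this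
    norm_num at this
    simpa using this

/-- For b = `yExp n j` the number n − 3b is even, so 3b ≤ n + 2 leaves either an honest monomial X^a
Y^b or the borderline 3b = n + 2, where the exponent of X is −1. -/
theorem yExp_le_of_lt_numF {n j : ℕ} (h : j < numF n) :
    4 ≤ n ∧ (3 * yExp n j ≤ n ∧ (n - 3 * yExp n j) % 2 = 0 ∨ 3 * yExp n j = n + 2) := by
  unfold numF at h
  unfold yExp
  split_ifs at h <;> omega

theorem yExp_le_of_lt_numG {n j : ℕ} (h : j < numG n) :
    5 ≤ n ∧ 3 * yExp n j + 4 ≤ n ∧ (n - 4 - 3 * yExp n j) % 2 = 0 := by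
  unfold numG at h
  unfold yExp
  split_ifs at h <;> omega

/-- The slope starts with (3/2) a₃ t; the factor 2/3 in the borderline column makes its leading
coefficient a₃^b, as for a true monomial. -/
theorem exists_monoF_eq {y : A⟦X⟧} (hy : ∀ j < 3, PowerSeries.coeff j y = 0) {n j : ℕ}
    (h : j < numF n) : ∃ v, monoF y n j = PowerSeries.X ^ n * v ∧
      PowerSeries.constantCoeff v = PowerSeries.coeff 3 y ^ yExp n j := by
  obtain ⟨z, hz, hz0⟩ := exists_eq_X_pow_mul hy
  obtain ⟨v, hv, hv0⟩ := exists_slope_eq hy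
  obtain ⟨hn, h | h⟩ := yExp_le_of_lt_numF h
  · refine ⟨z ^ yExp n j, ?_, by rw [map_pow, hz0]⟩
    rw [monoF, if_pos h.1]
    nth_rewrite 1 [hz]
    rw [mul_pow, ← pow_mul, ← mul_assoc, ← pow_add, Nat.sub_add_cancel h.1]
  · refine ⟨PowerSeries.C (algebraMap ℂ A (2 / 3)) * (z ^ (yExp n j - 1) * v), ?_, ?_⟩
    · rw [monoF, if_neg (by omega), hv]
      nth_rewrite 1 [hz]
      obtain ⟨m, hm⟩ : ∃ m, yExp n j = m + 1 := ⟨yExp n j - 1, by omega⟩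
      obtain rfl : n = 3 * m + 1 := by omega
      rw [hm]
      simp only [Nat.add_sub_cancel]
      ring
    · obtain ⟨m, hm⟩ : ∃ m, yExp n j = m + 1 := ⟨yExp n j - 1, by omega⟩
      simp only [map_mul, map_pow, hz0, hv0, PowerSeries.constantCoeff_C, hm, Nat.add_sub_cancel]
      have : algebraMap ℂ A (2 / 3) * algebraMap ℂ A (3 / 2) = 1 := by
        rw [← map_mul]; norm_num
      calc _ = (algebraMap ℂ A (2 / 3) * algebraMap ℂ A (3 / 2)) *
            (PowerSeries.coeff 3 y ^ m * PowerSeries.coeff 3 y) := by ring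
        _ = _ := by rw [this]; ring

/-- The defect is a₄t⁴ + 2a₅t⁵ + …. The next coefficient, in the case a₄ = 0, is needed only for the
exceptional weight. -/
theorem exists_monoG_eq {y : A⟦X⟧} (hy : ∀ j < 3, PowerSeries.coeff j y = 0) {n j : ℕ}
    (h : j < numG n) : ∃ v, monoG y n j = PowerSeries.X ^ n * v ∧
      PowerSeries.constantCoeff v = PowerSeries.coeff 4 y * PowerSeries.coeff 3 y ^ yExp n j ∧
      (PowerSeries.coeff 4 y = 0 → PowerSeries.coeff 1 v =
        2 * PowerSeries.coeff 5 y * PowerSeries.coeff 3 y ^ yExp n j) := by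
  obtain ⟨z, hz, hz0⟩ := exists_eq_X_pow_mul hy
  obtain ⟨v, hv, hv0, hv1⟩ := exists_defect_eq hy
  obtain ⟨hn, h, -⟩ := yExp_le_of_lt_numG h
  refine ⟨v * z ^ yExp n j, ?_, by rw [map_mul, map_pow, hz0, hv0], fun h4 => ?_⟩
  · rw [monoG, hv]
    nth_rewrite 1 [hz]
    have hX : (PowerSeries.X : A⟦X⟧) ^ n =
        PowerSeries.X ^ (n - 4 - 3 * yExp n j) * PowerSeries.X ^ (3 * yExp n j) *
          PowerSeries.X ^ 4 := by
      rw [← pow_add, ← pow_add]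
      congr 1
      omega
    rw [hX, mul_pow, ← pow_mul]
    ring
  · obtain ⟨u, hu⟩ : PowerSeries.X ∣ v := by
      rw [PowerSeries.X_dvd_iff, hv0, h4]
    have hu0 : PowerSeries.constantCoeff u = 2 * PowerSeries.coeff 5 y := by
      rw [← hv1, hu, ← zero_add 1, PowerSeries.coeff_succ_X_mul]
      simp
    have := PowerSeries.coeff_succ_X_mul 0 (u * z ^ yExp n j)
    rw [zero_add] at this
    rw [hu, mul_assoc, this]
    simp [hu0, hz0]

theorem coeff_col_of_lt {y : A⟦X⟧} (hy : ∀ j < 3, PowerSeries.coeff j y = 0) {n m : ℕ}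
    (h : m < n) (j) : PowerSeries.coeff m (col y n j) = 0 := by
  have : PowerSeries.X ^ n ∣ col y n j := by
    rcases j with j | j
    · obtain ⟨v, hv, -⟩ := exists_monoF_eq hy j.2
      exact ⟨v, hv⟩
    · obtain ⟨v, hv, -⟩ := exists_monoG_eq hy j.2
      exact ⟨v, hv⟩
  exact PowerSeries.X_pow_dvd_iff.1 this m h

theorem coeff_col_inl {y : A⟦X⟧} (hy : ∀ j < 3, PowerSeries.coeff j y = 0) (n : ℕ) (j) :
    PowerSeries.coeff n (col y n (Sum.inl j)) = PowerSeries.coeff 3 y ^ yExp n j := by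
  obtain ⟨v, hv, h0⟩ := exists_monoF_eq hy j.2
  rw [col, Sum.elim_inl, hv]
  simpa [h0] using PowerSeries.coeff_X_pow_mul v n 0

theorem coeff_col_inr {y : A⟦X⟧} (hy : ∀ j < 3, PowerSeries.coeff j y = 0) (n : ℕ) (j) :
    PowerSeries.coeff n (col y n (Sum.inr j)) =
      PowerSeries.coeff 4 y * PowerSeries.coeff 3 y ^ yExp n j := by
  obtain ⟨v, hv, h0, -⟩ := exists_monoG_eq hy j.2
  rw [col, Sum.elim_inr, hv]
  simpa [h0] using PowerSeries.coeff_X_pow_mul v n 0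

theorem coeff_succ_col_inr {y : A⟦X⟧} (hy : ∀ j < 3, PowerSeries.coeff j y = 0)
    (h4 : PowerSeries.coeff 4 y = 0) (n : ℕ) (j) :
    PowerSeries.coeff (n + 1) (col y n (Sum.inr j)) =
      2 * PowerSeries.coeff 5 y * PowerSeries.coeff 3 y ^ yExp n j := by
  obtain ⟨v, hv, -, h1⟩ := exists_monoG_eq hy j.2
  rw [col, Sum.elim_inr, hv, add_comm, PowerSeries.coeff_X_pow_mul, h1 h4]

end Columns

/-! ### The fractional ideal and the span of the columns -/

theorem derivative_eq_slope {y : ℂ⟦X⟧} (hy : ∀ j < 3, PowerSeries.coeff j y = 0) :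
    PowerSeries.derivative ℂ y = 2 * PowerSeries.X * slope y := by
  have h2 : (2 : ℂ⟦X⟧) = PowerSeries.C 2 := (map_ofNat PowerSeries.C 2).symm
  ext n
  rw [h2, mul_assoc, PowerSeries.coeff_C_mul, PowerSeries.coeff_derivative]
  rcases n with - | n
  · simp [hy 1]
  · rw [PowerSeries.coeff_succ_X_mul, slope, PowerSeries.coeff_mk]
    simp
    ring

namespace Multigerm

variable {r : ℕ} (φ : Multigerm r)

theorem hasSubst (i : Fin r) : MvPowerSeries.HasSubst ![φ.x i, φ.y i] := by
  refine MvPowerSeries.hasSubst_of_constantCoeff_zero fun s => ?_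
  fin_cases s
  · exact φ.x_zero i
  · exact φ.y_zero i

/-- The pullback as an algebra homomorphism. -/
def pullbackHom (i : Fin r) : ConvergentSeries (Fin 2) →ₐ[ℂ] ℂ⟦X⟧ :=
  (MvPowerSeries.substAlgHom (φ.hasSubst i)).comp (ConvergentSeries (Fin 2)).val

theorem pullback_eq (i : Fin r) (h : ConvergentSeries (Fin 2)) :
    φ.pullback i h = φ.pullbackHom i h := by
  simp only [pullback, pullbackHom, AlgHom.comp_apply, Subalgebra.coe_val]
  rw [MvPowerSeries.substAlgHom_apply]

theorem pullbackHom_coordX (i : Fin r) : φ.pullbackHom i coordX = φ.x i := by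
  rw [← pullback_eq]
  exact MvPowerSeries.subst_X (φ.hasSubst i) 0

theorem pullbackHom_coordY (i : Fin r) : φ.pullbackHom i coordY = φ.y i := by
  rw [← pullback_eq]
  exact MvPowerSeries.subst_X (φ.hasSubst i) 1

/-- The fractional ideal `idealI` as a complex vector space. -/
def idealSubmodule : Submodule ℂ (Fin r → ℂ⟦X⟧) where
  carrier := φ.idealI
  add_mem' := by
    rintro w w' ⟨a, ha, b, hb, h⟩ ⟨a', ha', b', hb', h'⟩
    refine ⟨a + a', add_mem ha ha', b + b', add_mem hb hb', fun i => ?_⟩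
    rw [Pi.add_apply, mul_add, h, h']
    simp only [pullbackForm, pullback_eq, map_add, map_neg]
    ring
  zero_mem' := ⟨0, zero_mem _, 0, zero_mem _, fun i => by
    simp [pullbackForm, pullback_eq]⟩
  smul_mem' := by
    rintro c w ⟨a, ha, b, hb, h⟩
    refine ⟨c • a, Submodule.smul_of_tower_mem _ c ha, c • b,
      Submodule.smul_of_tower_mem _ c hb, fun i => ?_⟩
    rw [Pi.smul_apply, mul_smul_comm, h]
    simp only [pullbackForm, pullback_eq, map_smul, map_neg]
    simp only [PowerSeries.smul_eq_C_mul]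
    ring

theorem mem_idealSubmodule {w : Fin r → ℂ⟦X⟧} : w ∈ φ.idealSubmodule ↔ w ∈ φ.idealI := Iff.rfl

variable {φ}

theorem IsPuiseuxBlock.x_eq (hφ : φ.IsPuiseuxBlock 2 3) (i : Fin r) :
    φ.x i = PowerSeries.X ^ 2 := (hφ i).1

theorem IsPuiseuxBlock.coeff_y (hφ : φ.IsPuiseuxBlock 2 3) (i : Fin r) :
    ∀ j < 3, PowerSeries.coeff j (φ.y i) = 0 := (hφ i).2

theorem IsPuiseuxBlock.mult_eq (hφ : φ.IsPuiseuxBlock 2 3) (i : Fin r) : φ.mult i = 2 := by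
  have h : (2 : ℕ∞) ≤ (φ.y i).order := by
    refine PowerSeries.le_order _ 2 fun j hj => hφ.coeff_y i j ?_
    have : j < 2 := by exact_mod_cast hj
    omega
  rw [mult, hφ.x_eq, PowerSeries.order_X_pow, min_eq_left (by exact_mod_cast h)]
  rfl

theorem IsPuiseuxBlock.mem_idealSubmodule_iff (hφ : φ.IsPuiseuxBlock 2 3)
    {w : Fin r → ℂ⟦X⟧} : w ∈ φ.idealSubmodule ↔
      ∃ η₁ ∈ (Ideal.span {coordX ^ 2, coordY} : Ideal (ConvergentSeries (Fin 2))),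
      ∃ η₂ ∈ (Ideal.span {coordX, coordY} : Ideal (ConvergentSeries (Fin 2))) ^ 2,
      ∀ i, w i = φ.pullbackHom i η₂ - φ.pullbackHom i η₁ * slope (φ.y i) := by
  rw [mem_idealSubmodule]
  refine exists_congr fun η₁ => and_congr_right fun _ => exists_congr fun η₂ =>
    and_congr_right fun _ => forall_congr' fun i => ?_
  have hd : PowerSeries.derivative ℂ ((PowerSeries.X : ℂ⟦X⟧) ^ 2) = 2 * PowerSeries.X := by
    simp [PowerSeries.derivative_X]
  have h2 : (2 : ℂ⟦X⟧) * PowerSeries.X ^ 2 ≠ 0 :=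
    mul_ne_zero (by
      rw [← map_ofNat (PowerSeries.C (R := ℂ)) 2]
      exact (map_ne_zero_iff _ PowerSeries.C_injective).2 two_ne_zero)
      (pow_ne_zero _ PowerSeries.X_ne_zero)
  have hform : φ.pullbackForm i η₂ (-η₁) = 2 * PowerSeries.X ^ 2 *
      (φ.pullbackHom i η₂ - φ.pullbackHom i η₁ * slope (φ.y i)) := by
    rw [pullbackForm, hφ.x_eq, hd, derivative_eq_slope (hφ.coeff_y i), pullback_eq, pullback_eq,
      map_neg]
    ring
  rw [hform, hφ.mult_eq]
  exact mul_right_inj' h2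

variable (φ)

/-- The span of all columns. -/
def colSpan : Submodule ℂ (Fin r → ℂ⟦X⟧) :=
  Submodule.span ℂ (Set.range fun p : Σ n, Fin (numF n) ⊕ Fin (numG n) =>
    fun i => col (φ.y i) p.1 p.2)

variable {φ}

theorem monoF_mem_colSpan {n j : ℕ} (h : j < numF n) :
    (fun i => monoF (φ.y i) n j) ∈ φ.colSpan :=
  Submodule.subset_span ⟨⟨n, Sum.inl ⟨j, h⟩⟩, rfl⟩

theorem monoG_mem_colSpan {n j : ℕ} (h : j < numG n) :
    (fun i => monoG (φ.y i) n j) ∈ φ.colSpan :=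
  Submodule.subset_span ⟨⟨n, Sum.inr ⟨j, h⟩⟩, rfl⟩

theorem monomial_mem_colSpan {a b : ℕ} (h : 2 ≤ a + b) :
    (fun i => PowerSeries.X ^ (2 * a) * φ.y i ^ b) ∈ φ.colSpan := by
  have hb : yExp (2 * a + 3 * b) (b / 2) = b := by unfold yExp; omega
  have hlt : b / 2 < numF (2 * a + 3 * b) := by
    unfold numF
    split_ifs <;> omega
  convert monoF_mem_colSpan (φ := φ) hlt using 2 with i
  rw [monoF, hb, if_pos (by omega)]
  congr 2
  omega

theorem pow_mul_slope_mem_colSpan {b : ℕ} (h : 1 ≤ b) :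
    (fun i => φ.y i ^ b * slope (φ.y i)) ∈ φ.colSpan := by
  have hb : yExp (3 * b + 1) ((b + 1) / 2) = b + 1 := by unfold yExp; omega
  have hlt : (b + 1) / 2 < numF (3 * b + 1) := by
    unfold numF
    split_ifs <;> omega
  convert φ.colSpan.smul_mem (3 / 2 : ℂ) (monoF_mem_colSpan (φ := φ) hlt) using 1
  funext i
  rw [Pi.smul_apply, monoF, hb, if_neg (by omega), PowerSeries.smul_eq_C_mul, ← mul_assoc,
    ← map_mul]
  norm_num

theorem monomial_mul_defect_mem_colSpan {a b : ℕ} (h : 1 ≤ a + b) :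
    (fun i => PowerSeries.X ^ (2 * a) * φ.y i ^ b * defect (φ.y i)) ∈ φ.colSpan := by
  have hb : yExp (2 * a + 3 * b + 4) (b / 2) = b := by unfold yExp; omega
  have hlt : b / 2 < numG (2 * a + 3 * b + 4) := by
    have : (2 * a + 3 * b + 4) % 2 = b % 2 := by omega
    unfold numG
    rw [this]
    split_ifs <;> omega
  convert monoG_mem_colSpan (φ := φ) hlt using 2 with i
  rw [monoG, hb, show 2 * a + 3 * b + 4 - 4 - 3 * b = 2 * a by omega]

/-- Solve the definition of the defect for x dy/dx: it is D/2 + (3/2) y. -/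
theorem monomial_mul_slope_mem_colSpan {a b : ℕ} (h : 1 ≤ a + b) :
    (fun i => PowerSeries.X ^ (2 * (a + 1)) * φ.y i ^ b * slope (φ.y i)) ∈ φ.colSpan := by
  have h1 := φ.colSpan.smul_mem (1 / 2 : ℂ) (monomial_mul_defect_mem_colSpan (φ := φ) h)
  have h2 := φ.colSpan.smul_mem (3 / 2 : ℂ)
    (monomial_mem_colSpan (φ := φ) (a := a) (b := b + 1) (by omega))
  convert add_mem h1 h2 using 1
  funext i
  have e1 : PowerSeries.C (1 / 2 : ℂ) * 2 = 1 := by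
    rw [← map_ofNat (PowerSeries.C (R := ℂ)) 2, ← map_mul]; norm_num
  have e2 : PowerSeries.C (3 / 2 : ℂ) = PowerSeries.C (1 / 2 : ℂ) * 3 := by
    rw [← map_ofNat (PowerSeries.C (R := ℂ)) 3, ← map_mul]; norm_num
  simp only [Pi.add_apply, Pi.smul_apply, PowerSeries.smul_eq_C_mul]
  rw [e2, defect]
  linear_combination (-(PowerSeries.X ^ (2 * (a + 1)) * φ.y i ^ b * slope (φ.y i))) * e1

theorem coordY_mul_mem (f : ConvergentSeries (Fin 2)) :
    f * coordY ∈ Ideal.span {coordX ^ 2, coordY} :=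
  Ideal.mul_mem_left _ _ (Ideal.subset_span (by simp))

theorem monomial_mem_sq {a b : ℕ} (h : 2 ≤ a + b) : coordX ^ a * coordY ^ b ∈
    (Ideal.span {coordX, coordY} : Ideal (ConvergentSeries (Fin 2))) ^ 2 := by
  refine Ideal.pow_le_pow_right h ?_
  rw [pow_add]
  exact Ideal.mul_mem_mul (Ideal.pow_mem_pow (Ideal.subset_span (by simp)) _)
    (Ideal.pow_mem_pow (Ideal.subset_span (by simp)) _)

theorem IsPuiseuxBlock.colSpan_le (hφ : φ.IsPuiseuxBlock 2 3) :
    φ.colSpan ≤ φ.idealSubmodule := by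
  have hX : ∀ i, φ.pullbackHom i coordX = PowerSeries.X ^ 2 := fun i => by
    rw [pullbackHom_coordX, hφ.x_eq]
  refine Submodule.span_le.2 ?_
  rintro _ ⟨⟨n, j | j⟩, rfl⟩
  · obtain ⟨hn, h | h⟩ := yExp_le_of_lt_numF j.2
    · refine hφ.mem_idealSubmodule_iff.2 ⟨0, zero_mem _,
        coordX ^ ((n - 3 * yExp n j) / 2) * coordY ^ yExp n j,
        monomial_mem_sq (by omega), fun i => ?_⟩
      simp only [col, Sum.elim_inl, monoF, if_pos h.1, map_mul, map_pow, map_zero, hX,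
        pullbackHom_coordY, ← pow_mul]
      rw [Nat.mul_div_cancel' (Nat.dvd_of_mod_eq_zero h.2)]
      ring
    · obtain ⟨m, hm⟩ : ∃ m, yExp n j = m + 2 := ⟨yExp n j - 2, by omega⟩
      refine hφ.mem_idealSubmodule_iff.2 ⟨(-(2 / 3) : ℂ) • (coordY ^ m * coordY),
        Submodule.smul_of_tower_mem _ _ (coordY_mul_mem _), 0, zero_mem _, fun i => ?_⟩
      simp only [col, Sum.elim_inl, monoF, hm, if_neg (show ¬ 3 * (m + 2) ≤ n by omega), map_smul,
        map_mul, map_pow, map_zero, pullbackHom_coordY, PowerSeries.smul_eq_C_mul, map_neg]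
      simp only [show m + 2 - 1 = m + 1 from rfl]
      simp
      ring
  · obtain ⟨hn, h, h'⟩ := yExp_le_of_lt_numG j.2
    obtain ⟨a, ha⟩ : ∃ a, n - 4 - 3 * yExp n j = 2 * a := ⟨(n - 4 - 3 * yExp n j) / 2, by omega⟩
    have hmem : coordX ^ (a + 1) * coordY ^ yExp n j ∈ Ideal.span {coordX ^ 2, coordY} := by
      rcases Nat.eq_zero_or_pos (yExp n j) with h0 | h0
      -- Here b = 0, and n ≥ 5 forces a ≥ 1, so X^(a+1) is divisible by X².
      · obtain ⟨c, rfl⟩ : ∃ c, a = c + 1 := ⟨a - 1, by omega⟩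
        rw [h0, show coordX ^ (c + 1 + 1) * coordY ^ 0 = coordX ^ c * coordX ^ 2 by ring]
        exact Ideal.mul_mem_left _ _ (Ideal.subset_span (by simp))
      · obtain ⟨c, hc⟩ : ∃ c, yExp n j = c + 1 := ⟨yExp n j - 1, by omega⟩
        rw [hc, show coordX ^ (a + 1) * coordY ^ (c + 1) =
          coordX ^ (a + 1) * coordY ^ c * coordY by ring]
        exact coordY_mul_mem _
    -- Read off from x^a y^b (2x dy/dx − 3y) = η₂ − η₁ dy/dx.
    refine hφ.mem_idealSubmodule_iff.2 ⟨-2 * (coordX ^ (a + 1) * coordY ^ yExp n j),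
      Ideal.mul_mem_left _ _ hmem, -3 * (coordX ^ a * coordY ^ (yExp n j + 1)),
      Ideal.mul_mem_left _ _ (monomial_mem_sq (by omega)), fun i => ?_⟩
    simp only [col, Sum.elim_inr, monoG, map_mul, map_pow, map_neg, hX,
        pullbackHom_coordY, ← pow_mul, map_ofNat, defect, ha]
    ring

/-- Both components of a branch have positive order, so terms of total degree at least N pull back
to order at least N. -/
theorem IsPuiseuxBlock.exists_polynomial (hφ : φ.IsPuiseuxBlock 2 3)
    (f : ConvergentSeries (Fin 2)) (N : ℕ) : ∃ p : MvPolynomial (Fin 2) ℂ, ∀ i,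
      PowerSeries.X ^ N ∣
        φ.pullbackHom i f - MvPolynomial.aeval ![PowerSeries.X ^ 2, φ.y i] p := by
  refine ⟨MvPowerSeries.truncTotal N (f : MvPowerSeries (Fin 2) ℂ), fun i => ?_⟩
  refine PowerSeries.X_pow_dvd_iff.2 fun m hm => ?_
  have h0 : ∀ s, MvPowerSeries.constantCoeff (![φ.x i, φ.y i] s) = 0 := by
    intro s
    fin_cases s
    · exact φ.x_zero i
    · exact φ.y_zero i
  have h := congrArg (MvPolynomial.coeff (Finsupp.single () m))
    (MvPowerSeries.truncTotal_subst_eq_truncTotal_truncTotal_subst (k := N)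
      (f := (f : MvPowerSeries (Fin 2) ℂ)) h0)
  rw [MvPowerSeries.coeff_truncTotal _ (by simpa using hm),
    MvPowerSeries.coeff_truncTotal _ (by simpa using hm), MvPowerSeries.subst_coe] at h
  rw [map_sub, sub_eq_zero, ← pullback_eq, ← hφ.x_eq i]
  exact h

theorem aeval_mul_mem {R : Submodule ℂ (Fin r → ℂ⟦X⟧)} {c : Fin r → ℂ⟦X⟧}
    (h : ∀ a b : ℕ, (fun i => PowerSeries.X ^ (2 * a) * φ.y i ^ b * c i) ∈ R)
    (p : MvPolynomial (Fin 2) ℂ) :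
    (fun i => MvPolynomial.aeval ![PowerSeries.X ^ 2, φ.y i] p * c i) ∈ R := by
  induction p using MvPolynomial.induction_on' with
  | monomial d z =>
    convert R.smul_mem z (h (d 0) (d 1)) using 1
    funext i
    rw [MvPolynomial.aeval_monomial, Finsupp.prod_fintype _ _ (by simp)]
    simp only [Fin.prod_univ_two, Matrix.cons_val_zero, Matrix.cons_val_one, Pi.smul_apply,
      PowerSeries.smul_eq_C_mul, ← pow_mul]
    rw [show algebraMap ℂ ℂ⟦X⟧ z = PowerSeries.C z from rfl]
    ring
  | add p q hp hq =>
    convert add_mem hp hq using 1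
    funext i
    simp [add_mul]

theorem exists_of_mem_sq {f : ConvergentSeries (Fin 2)} (h : f ∈
    (Ideal.span {coordX, coordY} : Ideal (ConvergentSeries (Fin 2))) ^ 2) :
    ∃ p q s, f = p * coordX ^ 2 + q * (coordX * coordY) + s * coordY ^ 2 := by
  rw [pow_two] at h
  refine Submodule.mul_induction_on h ?_ ?_
  · intro m hm n hn
    obtain ⟨a, b, rfl⟩ := Ideal.mem_span_pair.1 hm
    obtain ⟨a', b', rfl⟩ := Ideal.mem_span_pair.1 hn
    exact ⟨a * a', a * b' + b * a', b * b', by ring⟩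
  · rintro _ _ ⟨p, q, s, rfl⟩ ⟨p', q', s', rfl⟩
    exact ⟨p + p', q + q', s + s', by ring⟩

/-- Write η₁ and η₂ through generators of their ideals and truncate the coefficients to polynomials;
each resulting monomial times a generator is a combination of columns. -/
theorem IsPuiseuxBlock.exists_approx (hφ : φ.IsPuiseuxBlock 2 3) {w : Fin r → ℂ⟦X⟧}
    (hw : w ∈ φ.idealSubmodule) (N : ℕ) :
    ∃ w' ∈ φ.colSpan, ∀ i, PowerSeries.X ^ N ∣ w i - w' i := by
  obtain ⟨η₁, h₁, η₂, h₂, h⟩ := hφ.mem_idealSubmodule_iff.1 hw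
  obtain ⟨f, g, rfl⟩ := Ideal.mem_span_pair.1 h₁
  obtain ⟨p, q, s, rfl⟩ := exists_of_mem_sq h₂
  obtain ⟨f', hf⟩ := hφ.exists_polynomial f N
  obtain ⟨g', hg⟩ := hφ.exists_polynomial g N
  obtain ⟨p', hp⟩ := hφ.exists_polynomial p N
  obtain ⟨q', hq⟩ := hφ.exists_polynomial q N
  obtain ⟨s', hs⟩ := hφ.exists_polynomial s N
  have mf := aeval_mul_mem (φ := φ) (R := φ.colSpan)
    (c := fun i => PowerSeries.X ^ 4 * slope (φ.y i)) (fun a b => by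
      convert monomial_mul_slope_mem_colSpan (φ := φ) (a := a + 1) (b := b) (by omega)
        using 2
      ring) f'
  have mg := aeval_mul_mem (φ := φ) (R := φ.colSpan)
    (c := fun i => φ.y i * slope (φ.y i)) (fun a b => by
      -- Without a factor x the product y^(b+1) dy/dx is a multiple of the column X⁻¹Y^(b+2); with
      -- one, the defect is used.
      rcases a with - | a
      · convert pow_mul_slope_mem_colSpan (φ := φ) (b := b + 1) (by omega) using 2
        ring
      · convert monomial_mul_slope_mem_colSpan (φ := φ) (a := a) (b := b + 1) (by omega)
          using 2
        ring) g'
  have mp := aeval_mul_mem (φ := φ) (R := φ.colSpan)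
    (c := fun i => PowerSeries.X ^ 4) (fun a b => by
      convert monomial_mem_colSpan (φ := φ) (a := a + 2) (b := b) (by omega) using 2
      ring) p'
  have mq := aeval_mul_mem (φ := φ) (R := φ.colSpan)
    (c := fun i => PowerSeries.X ^ 2 * φ.y i) (fun a b => by
      convert monomial_mem_colSpan (φ := φ) (a := a + 1) (b := b + 1) (by omega) using 2
      ring) q'
  have ms := aeval_mul_mem (φ := φ) (R := φ.colSpan)
    (c := fun i => φ.y i ^ 2) (fun a b => by
      convert monomial_mem_colSpan (φ := φ) (a := a) (b := b + 2) (by omega) using 2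
      ring) s'
  refine ⟨_, sub_mem (add_mem (add_mem mp mq) ms) (add_mem mf mg), fun i => ?_⟩
  obtain ⟨f₁, hf⟩ := hf i
  obtain ⟨g₁, hg⟩ := hg i
  obtain ⟨p₁, hp⟩ := hp i
  obtain ⟨q₁, hq⟩ := hq i
  obtain ⟨s₁, hs⟩ := hs i
  rw [h i]
  simp only [map_add, map_mul, map_pow, pullbackHom_coordX, pullbackHom_coordY, hφ.x_eq,
    Pi.add_apply, Pi.sub_apply]
  refine ⟨p₁ * PowerSeries.X ^ 4 + q₁ * (PowerSeries.X ^ 2 * φ.y i) + s₁ * φ.y i ^ 2 -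
    (f₁ * (PowerSeries.X ^ 4 * slope (φ.y i)) + g₁ * (φ.y i * slope (φ.y i))), ?_⟩
  linear_combination PowerSeries.X ^ 4 * hp + PowerSeries.X ^ 2 * φ.y i * hq + φ.y i ^ 2 * hs -
    PowerSeries.X ^ 4 * slope (φ.y i) * hf - φ.y i * slope (φ.y i) * hg

end Multigerm

/-! ### The space of k-th coefficients, and how it determines e(k) and L_k -/

namespace Multigerm

variable {r : ℕ} (φ : Multigerm r)

/-- The vectors of coefficients at `t ^ k` of the elements of the fractional ideal all of
whose components have order at least `k`. -/
def jetSpace (k : ℕ) : Submodule ℂ (Fin r → ℂ) where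
  carrier := {c | ∃ w ∈ φ.idealSubmodule, ∀ i, (∀ m < k, PowerSeries.coeff m (w i) = 0) ∧
    PowerSeries.coeff k (w i) = c i}
  add_mem' := by
    rintro c c' ⟨w, hw, h⟩ ⟨w', hw', h'⟩
    refine ⟨w + w', add_mem hw hw', fun i => ⟨fun m hm => ?_, ?_⟩⟩
    · simp [(h i).1 m hm, (h' i).1 m hm]
    · simp [(h i).2, (h' i).2]
  zero_mem' := ⟨0, zero_mem _, fun i => ⟨fun m _ => by simp, by simp⟩⟩
  smul_mem' := by
    rintro z c ⟨w, hw, h⟩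
    refine ⟨z • w, Submodule.smul_mem _ z hw, fun i => ⟨fun m hm => ?_, ?_⟩⟩
    · simp [(h i).1 m hm]
    · simp [(h i).2]

variable {φ} {k : ℕ}

theorem mem_jetSpace {c : Fin r → ℂ} : c ∈ φ.jetSpace k ↔ ∃ w ∈ φ.idealSubmodule,
    ∀ i, (∀ m < k, PowerSeries.coeff m (w i) = 0) ∧ PowerSeries.coeff k (w i) = c i := Iff.rfl

theorem trunc_eq_monomial_iff {f : ℂ⟦X⟧} {z : ℂ} :
    PowerSeries.trunc (k + 1) f = Polynomial.monomial k z ↔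
      (∀ m < k, PowerSeries.coeff m f = 0) ∧ PowerSeries.coeff k f = z := by
  constructor
  · intro h
    have hc : ∀ m < k + 1, PowerSeries.coeff m f = if k = m then z else 0 := fun m hm => by
      have := congrArg (fun p => Polynomial.coeff p m) h
      simpa [PowerSeries.coeff_trunc, hm, Polynomial.coeff_monomial] using this
    refine ⟨fun m hm => ?_, by simpa using hc k (by omega)⟩
    rw [hc m (by omega), if_neg (by omega)]
  · rintro ⟨h, h'⟩
    ext m
    rw [PowerSeries.coeff_trunc, Polynomial.coeff_monomial]
    rcases lt_trichotomy m k with hm | rfl | hm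
    · rw [if_pos (by omega), h m hm, if_neg (by omega)]
    · rw [if_pos (by omega), h', if_pos rfl]
    · rw [if_neg (by omega), if_neg (by omega)]

theorem mem_jetSpace_iff_trunc {c : Fin r → ℂ} : c ∈ φ.jetSpace k ↔ ∃ w ∈ φ.idealI,
    ∀ i, PowerSeries.trunc (k + 1) (w i) = Polynomial.monomial k (c i) := by
  simp only [trunc_eq_monomial_iff]
  rfl

theorem e_eq {d : ℕ} (hd : d ≤ r) (hrank : Module.finrank ℂ (φ.jetSpace k) ≤ d)
    (hs : ∀ b : Fin r → ℂ, ∃ c ∈ φ.jetSpace k, ∀ i : Fin r, i.val < d → c i = b i) :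
    φ.e k = d := by
  have hmem : d ∈ {e | e ≤ r ∧ ∀ b : Fin r → ℂ, ∃ c : Fin r → ℂ,
      (∀ i : Fin r, i.val < e → c i = b i) ∧
      ∃ w ∈ φ.idealI, ∀ i, PowerSeries.trunc (k + 1) (w i) = Polynomial.monomial k (c i)} := by
    refine ⟨hd, fun b => ?_⟩
    obtain ⟨c, hc, h⟩ := hs b
    exact ⟨c, h, mem_jetSpace_iff_trunc.1 hc⟩
  refine le_antisymm (csSup_le ⟨d, hmem⟩ ?_) (le_csSup ⟨r, fun e he => he.1⟩ hmem)
  rintro e ⟨her, he⟩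
  refine le_trans ?_ hrank
  let p : φ.jetSpace k →ₗ[ℂ] (Fin e → ℂ) :=
    (LinearMap.funLeft ℂ ℂ (Fin.castLE her)).comp (φ.jetSpace k).subtype
  have hp : Function.Surjective p := by
    intro b
    obtain ⟨c, hc, hw⟩ := he fun i => if h : i.val < e then b ⟨i, h⟩ else 0
    refine ⟨⟨c, mem_jetSpace_iff_trunc.2 hw⟩, ?_⟩
    funext i
    have := hc (Fin.castLE her i) i.2
    simpa [p, LinearMap.funLeft] using this
  simpa using LinearMap.finrank_le_finrank_of_surjective hp

theorem exists_mem_jetSpace_of_fiber {J : Finset (Fin r)} (h : (φ.fiber J k).Nonempty) :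
    ∃ c ∈ φ.jetSpace k, ∀ i, c i ≠ 0 ↔ i ∈ J := by
  obtain ⟨_, ⟨w, hw, rfl⟩, hJ, hJ'⟩ := h
  refine ⟨fun i => PowerSeries.coeff k (w i), ⟨w, hw, fun i => ⟨fun m hm => ?_, rfl⟩⟩,
    fun i => ?_⟩
  · refine PowerSeries.coeff_of_lt_order m ?_
    have hm' : (m : ℕ∞) < k := by exact_mod_cast hm
    by_cases hi : i ∈ J
    · exact hm'.trans_eq (hJ i hi).symm
    · exact hm'.trans (hJ' i hi)
  · by_cases hi : i ∈ J
    · simpa [hi] using ((PowerSeries.order_eq_nat).1 (hJ i hi)).1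
    · simpa [hi] using PowerSeries.coeff_of_lt_order k (hJ' i hi)

theorem fiber_nonempty {c : Fin r → ℂ} (h : c ∈ φ.jetSpace k) :
    (φ.fiber (Finset.univ.filter fun i => c i ≠ 0) k).Nonempty := by
  obtain ⟨w, hw, hc⟩ := h
  refine ⟨_, ⟨w, hw, rfl⟩, fun i hi => ?_, fun i hi => ?_⟩
  · refine PowerSeries.order_eq_nat.2 ⟨?_, (hc i).1⟩
    rw [(hc i).2]
    simpa using hi
  · have hi' : c i = 0 := by simpa using hi
    have : ((k + 1 : ℕ) : ℕ∞) ≤ (w i).order := by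
      refine PowerSeries.nat_le_order _ _ fun m hm => ?_
      rcases Nat.lt_succ_iff_lt_or_eq.1 hm with hm | rfl
      · exact (hc i).1 m hm
      · rw [(hc i).2, hi']
    refine lt_of_lt_of_le ?_ this
    exact_mod_cast Nat.lt_succ_self k

/-- Choose for each l ∈ L a vector with support J_l. Among the coordinates in L it is nonzero only
at l, so these vectors are independent. -/
theorem Star.card_le {L : Finset (Fin r)} (h : φ.Star k L) :
    L.card ≤ Module.finrank ℂ (φ.jetSpace k) := by
  obtain ⟨J, hJ⟩ := h
  choose c hc hcJ using fun l : L => exists_mem_jetSpace_of_fiber (hJ l l.2).2.2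
  have hli : LinearIndependent ℂ fun l : L => (⟨c l, hc l⟩ : φ.jetSpace k) := by
    rw [Fintype.linearIndependent_iff]
    intro g hg l
    have := congrArg (fun v : φ.jetSpace k => (v : Fin r → ℂ) l) hg
    simp only [AddSubmonoidClass.coe_finsetSum, Finset.sum_apply, Submodule.coe_smul,
      Pi.smul_apply, smul_eq_mul] at this
    rw [Finset.sum_eq_single l] at this
    · rcases mul_eq_zero.1 this with h0 | h0
      · exact h0
      · exact absurd h0 ((hcJ l l).2 (hJ l l.2).1)
    · intro i _ hi
      have : c i l = 0 := by
        by_contra h0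
        exact (hJ l l.2).2.1 i i.2 (fun h => hi (Subtype.ext h)) ((hcJ i l).1 h0)
      rw [this, mul_zero]
    · simp
  simpa using hli.fintype_card_le_finrank

theorem card_filter_lt {d : ℕ} (hd : d ≤ r) :
    (Finset.univ.filter fun i : Fin r => i.val < d).card = d := by
  simp [Fin.card_filter_val_lt, hd]

/-- Between sets of equal size, the first index at which the initial segment and L differ lies in
the segment and not in L. -/
theorem gradedKey_le {d : ℕ} (hd : d ≤ r) {L : Finset (Fin r)} (hL : L.card ≤ d) :
    gradedKey L ≤ gradedKey (Finset.univ.filter fun i : Fin r => i.val < d) := by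
  rw [gradedKey, gradedKey, Prod.Lex.le_iff]
  simp only [ofLex_toLex]
  rw [card_filter_lt hd]
  rcases hL.lt_or_eq with h | h
  · exact Or.inl h
  refine Or.inr ⟨h, ?_⟩
  set S := Finset.univ.filter fun i : Fin r => i.val < d with hS
  by_cases hSL : S ⊆ L
  · rw [Finset.eq_of_subset_of_card_le hSL (by rw [h, card_filter_lt hd])]
  · have hne : (S \ L).Nonempty := Finset.sdiff_nonempty.2 hSL
    set m := (S \ L).min' hne with hm
    have hmem := (S \ L).min'_mem hne
    rw [← hm, Finset.mem_sdiff] at hmem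
    refine le_of_lt ?_
    change Pi.Lex (· < ·) (· < ·) _ _
    refine ⟨m, fun j hj => ?_, by simp [hmem]⟩
    have hjS : j ∈ S := by
      have h1 : m.val < d := by simpa [hS] using hmem.1
      simp only [hS, Finset.mem_filter, Finset.mem_univ, true_and]
      exact lt_trans hj h1
    have hjL : j ∈ L := by
      by_contra hjL
      exact absurd ((S \ L).min'_le j (Finset.mem_sdiff.2 ⟨hjS, hjL⟩)) (not_le.2 hj)
    simp [hjS, hjL]

theorem isL_filter {d : ℕ} (hd : d ≤ r) (hrank : Module.finrank ℂ (φ.jetSpace k) ≤ d)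
    (hs : ∀ b : Fin r → ℂ, ∃ c ∈ φ.jetSpace k, ∀ i : Fin r, i.val < d → c i = b i) :
    φ.IsL k (Finset.univ.filter fun i : Fin r => i.val < d) := by
  refine ⟨?_, fun L' hL' => gradedKey_le hd (hL'.card_le.trans hrank)⟩
  -- Vectors whose first d coordinates are the unit vectors; their supports serve as the sets J_l.
  choose c hc hcb using fun l : Fin r => hs (Pi.single l 1)
  refine ⟨fun l => Finset.univ.filter fun i => c l i ≠ 0, fun l hl => ⟨?_, fun i hi hil => ?_,
    fiber_nonempty (hc l)⟩⟩
  · simp [hcb l l (by simpa using hl)]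
  · simp [hcb i l (by simpa using hl), Pi.single_eq_of_ne hil.symm]

end Multigerm

/-! ### Bounding the jet space by leading vectors -/

namespace Multigerm

variable {r : ℕ} (φ : Multigerm r)

/-- The vector of leading coefficients of a column of weight `n`. -/
def lead (n : ℕ) (j : Fin (numF n) ⊕ Fin (numG n)) : Fin r → ℂ :=
  fun i => PowerSeries.coeff n (col (φ.y i) n j)

variable {φ}

theorem exists_sum_of_mem_colSpan {w : Fin r → ℂ⟦X⟧} (hw : w ∈ φ.colSpan) (K : ℕ) :
    ∃ M, K ≤ M ∧ ∃ g : (Σ n, Fin (numF n) ⊕ Fin (numG n)) → ℂ, ∀ i,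
      w i = ∑ n ∈ Finset.range M, ∑ j, g ⟨n, j⟩ • col (φ.y i) n j := by
  obtain ⟨f, rfl⟩ := (Finsupp.mem_span_range_iff_exists_finsupp).1 hw
  refine ⟨max K (f.support.sup Sigma.fst + 1), le_max_left _ _, f, fun i => ?_⟩
  rw [← Finset.sum_sigma (Finset.range _) (fun _ => Finset.univ)
    (fun p => f p • col (φ.y i) p.1 p.2), Finsupp.sum, Finset.sum_apply]
  refine Finset.sum_subset (fun p hp => ?_) (fun p _ hp => ?_)
  · have : p.1 ≤ f.support.sup Sigma.fst := Finset.le_sup (f := Sigma.fst) hp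
    simp only [Finset.mem_sigma, Finset.mem_range, Finset.mem_univ, and_true]
    exact lt_max_of_lt_right (Nat.lt_succ_of_le this)
  · simp [Finsupp.notMem_support_iff.1 hp]

/-- Independence in each weight below k kills, weight by weight, every column of weight less than k
in an element of order at least k; at t^k only the leading vectors of weight k remain. -/
theorem IsPuiseuxBlock.jetSpace_le (hφ : φ.IsPuiseuxBlock 2 3) {k : ℕ}
    (hind : ∀ n < k, LinearIndependent ℂ (φ.lead n)) :
    φ.jetSpace k ≤ Submodule.span ℂ (Set.range (φ.lead k)) := by
  intro c hc
  obtain ⟨w, hw, hwc⟩ := mem_jetSpace.1 hc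
  obtain ⟨w', hw', happ⟩ := hφ.exists_approx hw (k + 1)
  obtain ⟨M, hM, g, hg⟩ := exists_sum_of_mem_colSpan hw' (k + 1)
  have hcoeff : ∀ n ≤ k, ∀ i, PowerSeries.coeff n (w i) = PowerSeries.coeff n (w' i) :=
    fun n hn i => by
      have := PowerSeries.X_pow_dvd_iff.1 (happ i) n (by omega)
      rwa [map_sub, sub_eq_zero] at this
  have key : ∀ n ≤ k, (∀ m < n, ∀ j, g ⟨m, j⟩ = 0) → ∀ i,
      PowerSeries.coeff n (w i) = ∑ j, g ⟨n, j⟩ * φ.lead n j i := by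
    intro n hn h0 i
    rw [hcoeff n hn, hg, map_sum, Finset.sum_eq_single n]
    · simp [lead]
    · intro m _ hmn
      rw [map_sum]
      refine Finset.sum_eq_zero fun j _ => ?_
      rcases lt_or_gt_of_ne hmn with h | h
      · simp [h0 m h j]
      · simp [coeff_col_of_lt (hφ.coeff_y i) h]
    · intro h
      exact absurd (Finset.mem_range.2 (by omega)) h
  -- The lowest weight still present contributes a vanishing combination of independent leading
  -- vectors.
  have hzero : ∀ n < k, ∀ j, g ⟨n, j⟩ = 0 := by
    intro n
    induction n using Nat.strong_induction_on with
    | _ n ih =>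
      intro hn
      refine Fintype.linearIndependent_iff.1 (hind n hn) _ ?_
      funext i
      have := key n hn.le (fun m hm => ih m hm (hm.trans hn)) i
      rw [(hwc i).1 n hn] at this
      simpa using this.symm
  have : c = ∑ j, g ⟨k, j⟩ • φ.lead k j := by
    funext i
    rw [← (hwc i).2, key k le_rfl hzero i]
    simp
  rw [this]
  exact Submodule.sum_mem _ fun j _ => Submodule.smul_mem _ _ (Submodule.subset_span ⟨j, rfl⟩)

theorem IsPuiseuxBlock.finrank_jetSpace_le (hφ : φ.IsPuiseuxBlock 2 3) {k : ℕ}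
    (hind : ∀ n < k, LinearIndependent ℂ (φ.lead n)) :
    Module.finrank ℂ (φ.jetSpace k) ≤ numF k + numG k := by
  refine (Submodule.finrank_mono (hφ.jetSpace_le hind)).trans ?_
  exact (finrank_range_le_card (R := ℂ) (φ.lead k)).trans (by simp)

theorem col_mem_idealSubmodule (hφ : φ.IsPuiseuxBlock 2 3) (n : ℕ) (j) :
    (fun i => col (φ.y i) n j) ∈ φ.idealSubmodule :=
  hφ.colSpan_le (Submodule.subset_span ⟨⟨n, j⟩, rfl⟩)

theorem IsPuiseuxBlock.lead_mem_jetSpace (hφ : φ.IsPuiseuxBlock 2 3) (n : ℕ) (j) :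
    φ.lead n j ∈ φ.jetSpace n :=
  ⟨_, col_mem_idealSubmodule hφ n j,
    fun i => ⟨fun _ hm => coeff_col_of_lt (hφ.coeff_y i) hm j, rfl⟩⟩

end Multigerm

/-! ### Two consecutive weights at once -/

/-- Rows `(i, n)` and `(i, n + 1)` of the coefficients of a family of series. -/
def twoCoeff {A : Type*} [CommRing A] {r : ℕ} (n : ℕ) (f : Fin r → A⟦X⟧) : Fin r ⊕ Fin r → A :=
  Sum.elim (fun i => PowerSeries.coeff n (f i)) (fun i => PowerSeries.coeff (n + 1) (f i))

/-- The columns of weights `n` and `n + 1`. -/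
def twoCol {A : Type*} [CommRing A] [Algebra ℂ A] (n : ℕ) (y : A⟦X⟧) :
    (Fin (numF n) ⊕ Fin (numG n)) ⊕ (Fin (numF (n + 1)) ⊕ Fin (numG (n + 1))) → A⟦X⟧ :=
  Sum.elim (col y n) (col y (n + 1))

/-- The matrix of the coefficients of weights `n`, `n + 1` of the columns of weights `n`,
`n + 1`. -/
def twoMatrix {A : Type*} [CommRing A] [Algebra ℂ A] {r : ℕ} (n : ℕ)
    (e : Fin r ⊕ Fin r ≃
      (Fin (numF n) ⊕ Fin (numG n)) ⊕ (Fin (numF (n + 1)) ⊕ Fin (numG (n + 1))))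
    (y : Fin r → A⟦X⟧) : Matrix (Fin r ⊕ Fin r) (Fin r ⊕ Fin r) A :=
  Matrix.of fun p q => twoCoeff n (fun i => twoCol n (y i) (e q)) p

theorem twoMatrix_map {A B : Type*} [CommRing A] [Algebra ℂ A] [CommRing B] [Algebra ℂ B]
    {r : ℕ} (n : ℕ) (e : Fin r ⊕ Fin r ≃
      (Fin (numF n) ⊕ Fin (numG n)) ⊕ (Fin (numF (n + 1)) ⊕ Fin (numG (n + 1))))
    (y : Fin r → A⟦X⟧) (f : A →ₐ[ℂ] B) :
    (twoMatrix n e y).map f = twoMatrix n e fun i => PowerSeries.map (f : A →+* B) (y i) := by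
  ext p q
  have h : ∀ i, twoCol n (PowerSeries.map (f : A →+* B) (y i)) (e q) =
      PowerSeries.map (f : A →+* B) (twoCol n (y i) (e q)) := by
    intro i
    rcases e q with c | c <;> exact (map_col f (y i) _ c).symm
  simp only [twoMatrix, Matrix.map_apply, Matrix.of_apply, h]
  rcases p with i | i <;> simp [twoCoeff]

namespace Multigerm

variable {r : ℕ} {φ : Multigerm r}

theorem IsPuiseuxBlock.jetSpace_succ_eq_top (hφ : φ.IsPuiseuxBlock 2 3) (n : ℕ)
    (e : Fin r ⊕ Fin r ≃
      (Fin (numF n) ⊕ Fin (numG n)) ⊕ (Fin (numF (n + 1)) ⊕ Fin (numG (n + 1))))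
    (hdet : (twoMatrix n e φ.y).det ≠ 0) : φ.jetSpace (n + 1) = ⊤ := by
  refine eq_top_iff.2 fun c _ => ?_
  have hunit : IsUnit (twoMatrix n e φ.y) :=
    (Matrix.isUnit_iff_isUnit_det _).2 (isUnit_iff_ne_zero.2 hdet)
  -- Coefficients 0 at t^n and c at t^(n+1), on all branches.
  obtain ⟨x, hx⟩ := Matrix.mulVec_surjective_iff_isUnit.2 hunit
    (Sum.elim (0 : Fin r → ℂ) c)
  refine ⟨∑ q, x q • fun i => twoCol n (φ.y i) (e q), Submodule.sum_mem _ fun q _ =>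
    Submodule.smul_mem _ _ ?_, fun i => ⟨fun m hm => ?_, ?_⟩⟩
  · rcases e q with j | j
    · exact col_mem_idealSubmodule hφ n j
    · exact col_mem_idealSubmodule hφ (n + 1) j
  · rcases Nat.lt_succ_iff_lt_or_eq.1 hm with h | rfl
    · rw [Finset.sum_apply, map_sum]
      refine Finset.sum_eq_zero fun q _ => ?_
      have : PowerSeries.coeff m (twoCol n (φ.y i) (e q)) = 0 := by
        rcases e q with j | j
        · exact coeff_col_of_lt (hφ.coeff_y i) h j
        · exact coeff_col_of_lt (hφ.coeff_y i) hm j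
      simp [this]
    · have := congrFun hx (Sum.inl i)
      simp only [Matrix.mulVec, dotProduct, twoMatrix, Matrix.of_apply, twoCoeff,
        Sum.elim_inl, Pi.zero_apply] at this
      rw [Finset.sum_apply, map_sum, ← this]
      exact Finset.sum_congr rfl fun q _ => by simp [mul_comm]
  · have := congrFun hx (Sum.inr i)
    simp only [Matrix.mulVec, dotProduct, twoMatrix, Matrix.of_apply, twoCoeff,
      Sum.elim_inr] at this
    rw [Finset.sum_apply, map_sum, ← this]
    exact Finset.sum_congr rfl fun q _ => by simp [mul_comm]

end Multigerm

/-! ### Nonvanishing of the generic determinants -/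

/-- The square matrix with rows `(a_i ^ (ε + 2 j), b_i a_i ^ (ε + 2 j'))`, `j < s`, `j' < t`, for
the first `s + t` indices `i`. -/
def leadMatrix {A : Type*} [CommRing A] {r : ℕ} (a b : Fin r → A) (ε : ℕ) {s t : ℕ}
    (h : s + t ≤ r) : Matrix (Fin s ⊕ Fin t) (Fin s ⊕ Fin t) A :=
  Matrix.of fun p q => Sum.elim
    (fun j : Fin s => a (Fin.castLE h (finSumFinEquiv p)) ^ (ε + 2 * j.val))
    (fun j : Fin t => b (Fin.castLE h (finSumFinEquiv p)) *
      a (Fin.castLE h (finSumFinEquiv p)) ^ (ε + 2 * j.val)) q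

theorem leadMatrix_map {A B : Type*} [CommRing A] [CommRing B] {r : ℕ} (a b : Fin r → A) (ε : ℕ)
    {s t : ℕ} (h : s + t ≤ r) (f : A →+* B) :
    (leadMatrix a b ε h).map f = leadMatrix (fun i => f (a i)) (fun i => f (b i)) ε h := by
  ext p (q | q) <;> simp [leadMatrix]

/-- A Vandermonde system in the distinct squares (k_i + 1)², after dividing by the nonzero factors
(k_i + 1)^ε. -/
theorem eq_zero_of_sum_mul_pow_eq_zero {s : ℕ} (ε : ℕ) {k : Fin s → ℕ}
    (hk : Function.Injective k) {x : Fin s → ℂ}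
    (h : ∀ i, ∑ j, x j * ((k i : ℂ) + 1) ^ (ε + 2 * j.val) = 0) : x = 0 := by
  have hne : ∀ n : ℕ, (n : ℂ) + 1 ≠ 0 := fun n => Nat.cast_add_one_ne_zero n
  refine Matrix.eq_zero_of_forall_index_sum_mul_pow_eq_zero
    (f := fun i => ((k i : ℂ) + 1) ^ 2) (fun i i' hii => hk ?_) fun i => ?_
  · have : (((k i + 1) ^ 2 : ℕ) : ℂ) = ((k i' + 1) ^ 2 : ℕ) := by
      push_cast
      exact hii
    have := Nat.pow_left_injective two_ne_zero (Nat.cast_injective this)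
    simpa using this
  · have hi := h i
    have : ∑ j, x j * ((k i : ℂ) + 1) ^ (ε + 2 * j.val) =
        ((k i : ℂ) + 1) ^ ε * ∑ j, x j * (((k i : ℂ) + 1) ^ 2) ^ j.val := by
      rw [Finset.mul_sum]
      refine Finset.sum_congr rfl fun j _ => ?_
      rw [pow_add, pow_mul]
      ring
    rw [this] at hi
    exact (mul_eq_zero.1 hi).resolve_left (pow_ne_zero _ (hne _))

theorem det_ne_zero_of_injective {ι : Type*} [Fintype ι] [DecidableEq ι] {M : Matrix ι ι ℂ}
    (h : ∀ v, M.mulVec v = 0 → v = 0) : M.det ≠ 0 := by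
  intro h0
  obtain ⟨v, hv, hMv⟩ := Matrix.exists_mulVec_eq_zero_iff.2 h0
  exact hv (h v hMv)

/-- With b zero on the first s rows and one on the rest, the matrix is block triangular with
Vandermonde-type diagonal blocks. -/
theorem exists_leadMatrix_det_ne_zero {r : ℕ} (ε : ℕ) {s t : ℕ} (h : s + t ≤ r) :
    (leadMatrix (fun i : Fin r => (i.val : ℂ) + 1) (fun i => if i.val < s then 0 else 1)
      ε h).det ≠ 0 := by
  refine det_ne_zero_of_injective fun v hv => ?_
  have hrow : ∀ p : Fin s ⊕ Fin t,
      ∑ j : Fin s, v (Sum.inl j) * (((finSumFinEquiv p).val : ℂ) + 1) ^ (ε + 2 * j.val) +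
      (if (finSumFinEquiv p).val < s then 0 else 1) * ∑ j : Fin t, v (Sum.inr j) *
        (((finSumFinEquiv p).val : ℂ) + 1) ^ (ε + 2 * j.val) = 0 := by
    intro p
    have := congrFun hv p
    simp only [Matrix.mulVec, dotProduct, Fintype.sum_sum_type, leadMatrix, Matrix.of_apply,
      Sum.elim_inl, Sum.elim_inr, Pi.zero_apply, Fin.val_castLE] at this
    rw [Finset.mul_sum]
    refine Eq.trans ?_ this
    congr 1
    · exact Finset.sum_congr rfl fun j _ => by ring
    · exact Finset.sum_congr rfl fun j _ => by ring
  have h1 : (fun j => v (Sum.inl j)) = 0 := by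
    refine eq_zero_of_sum_mul_pow_eq_zero ε (k := fun i : Fin s => i.val)
      Fin.val_injective fun i => ?_
    have := hrow (Sum.inl i)
    simpa using this
  have h2 : (fun j => v (Sum.inr j)) = 0 := by
    refine eq_zero_of_sum_mul_pow_eq_zero ε (k := fun i : Fin t => s + i.val)
      (fun i i' hii => Fin.ext (by simpa using hii)) fun i => ?_
    have := hrow (Sum.inr i)
    simpa [fun j => congrFun h1 j] using this
  funext q
  rcases q with q | q
  · exact congrFun h1 q
  · exact congrFun h2 q

/-- The polynomial in the coefficients `a_{i3}`, `a_{i4}` given by the determinant of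
`leadMatrix`. -/
def leadPoly {r : ℕ} (ε : ℕ) {s t : ℕ} (h : s + t ≤ r) : MvPolynomial (Fin r × ℕ) ℂ :=
  (leadMatrix (fun i : Fin r => MvPolynomial.X (i, 0)) (fun i => MvPolynomial.X (i, 1)) ε h).det

theorem eval_leadPoly {r : ℕ} (v : Fin r × ℕ → ℂ) (ε : ℕ) {s t : ℕ} (h : s + t ≤ r) :
    MvPolynomial.eval v (leadPoly ε h) =
      (leadMatrix (fun i => v (i, 0)) (fun i => v (i, 1)) ε h).det := by
  rw [leadPoly, RingHom.map_det, RingHom.mapMatrix_apply, leadMatrix_map]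
  simp

theorem leadPoly_ne_zero {r : ℕ} (ε : ℕ) {s t : ℕ} (h : s + t ≤ r) :
    leadPoly (r := r) ε h ≠ 0 := by
  intro h0
  refine exists_leadMatrix_det_ne_zero ε h ?_
  have := eval_leadPoly (fun p : Fin r × ℕ => if p.2 = 0 then (p.1.val : ℂ) + 1 else
    if p.1.val < s then 0 else 1) ε h
  rw [h0] at this
  simpa using this.symm

/-- The branch `∑ v_j t ^ (j + 3)`. -/
def branch {A : Type*} [CommRing A] (v : ℕ → A) : A⟦X⟧ :=
  PowerSeries.mk fun j => if j < 3 then 0 else v (j - 3)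

theorem coeff_branch_of_lt {A : Type*} [CommRing A] (v : ℕ → A) :
    ∀ j < 3, PowerSeries.coeff j (branch v) = 0 := fun j hj => by simp [branch, hj]

theorem coeff_branch {A : Type*} [CommRing A] (v : ℕ → A) (j : ℕ) :
    PowerSeries.coeff (j + 3) (branch v) = v j := by simp [branch]

/-- The determinant of `twoMatrix` for the branches with indeterminate coefficients. -/
def twoPoly {r : ℕ} (n : ℕ) (e : Fin r ⊕ Fin r ≃
      (Fin (numF n) ⊕ Fin (numG n)) ⊕ (Fin (numF (n + 1)) ⊕ Fin (numG (n + 1)))) :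
    MvPolynomial (Fin r × ℕ) ℂ :=
  (twoMatrix n e fun i => branch fun j => MvPolynomial.X (i, j)).det

theorem eval_twoPoly {r : ℕ} (n : ℕ) (e : Fin r ⊕ Fin r ≃
      (Fin (numF n) ⊕ Fin (numG n)) ⊕ (Fin (numF (n + 1)) ⊕ Fin (numG (n + 1))))
    (v : Fin r × ℕ → ℂ) :
    MvPolynomial.eval v (twoPoly n e) = (twoMatrix n e fun i => branch fun j => v (i, j)).det := by
  have h : MvPolynomial.eval v (twoPoly n e) = MvPolynomial.aeval v (twoPoly n e) := by
    rw [MvPolynomial.aeval_eq_eval]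
  rw [h, twoPoly, AlgHom.map_det, AlgHom.mapMatrix_apply, twoMatrix_map]
  congr 2
  funext i
  ext j
  simp only [branch, PowerSeries.coeff_map, PowerSeries.coeff_mk]
  split_ifs <;> simp

theorem twoMatrix_mulVec {r n : ℕ} (e : Fin r ⊕ Fin r ≃
      (Fin (numF n) ⊕ Fin (numG n)) ⊕ (Fin (numF (n + 1)) ⊕ Fin (numG (n + 1))))
    (y : Fin r → ℂ⟦X⟧) (v : Fin r ⊕ Fin r → ℂ) (p : Fin r ⊕ Fin r) :
    (twoMatrix n e y).mulVec v p =
      ∑ j, v (e.symm (Sum.inl j)) * twoCoeff n (fun i => col (y i) n j) p +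
      ∑ j, v (e.symm (Sum.inr j)) * twoCoeff n (fun i => col (y i) (n + 1) j) p := by
  rw [Matrix.mulVec, dotProduct, ← e.symm.sum_comp, Fintype.sum_sum_type]
  simp [twoMatrix, twoCol, mul_comm]

/-- It suffices to find one choice of coefficients with trivial kernel. The specialization decouples
the system into Vandermonde systems for the four kinds of columns, solved in a suitable order. -/
theorem twoPoly_ne_zero (m : ℕ) (e : Fin (2 * m + 2) ⊕ Fin (2 * m + 2) ≃
      (Fin (numF (6 * m + 4)) ⊕ Fin (numG (6 * m + 4))) ⊕
      (Fin (numF (6 * m + 4 + 1)) ⊕ Fin (numG (6 * m + 4 + 1)))) (hm : 1 ≤ m) :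
    twoPoly (6 * m + 4) e ≠ 0 := by
  have hF : numF (6 * m + 4) = m + 2 := by unfold numF; split_ifs <;> omega
  have hG : numG (6 * m + 4) = m + 1 := by unfold numG; split_ifs <;> omega
  have hF' : numF (6 * m + 4 + 1) = m + 1 := by unfold numF; split_ifs <;> omega
  have hG' : numG (6 * m + 4 + 1) = m := by unfold numG; split_ifs <;> omega
  have hε : (6 * m + 4) % 2 = 0 := by omega
  have hε' : (6 * m + 4 + 1) % 2 = 1 := by omega
  intro h0
  -- a₃ = i + 1; a₄ vanishes on the first m+2 branches and is 1 on the last m; a₅ = 1 on branch 0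
  -- and 0 elsewhere. The coefficients beyond a₅ play no role.
  let v : Fin (2 * m + 2) × ℕ → ℂ := fun p =>
    if p.2 = 0 then (p.1.val : ℂ) + 1 else if p.2 = 1 then (if p.1.val < m + 2 then 0 else 1)
    else if p.1.val = 0 then 1 else 0
  have hdet := eval_twoPoly (6 * m + 4) e v
  rw [h0, map_zero] at hdet
  refine det_ne_zero_of_injective (fun x hx => ?_) hdet.symm
  set y : Fin (2 * m + 2) → ℂ⟦X⟧ := fun i => branch fun j => v (i, j) with hy
  have hy3 : ∀ i, PowerSeries.coeff 3 (y i) = (i.val : ℂ) + 1 := fun i => by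
    rw [hy]; exact (coeff_branch _ 0).trans (by simp [v])
  have hy4 : ∀ i, PowerSeries.coeff 4 (y i) = if i.val < m + 2 then 0 else 1 := fun i => by
    rw [hy]; exact (coeff_branch _ 1).trans (by simp [v])
  have hy5 : ∀ i, PowerSeries.coeff 5 (y i) = if i.val = 0 then 1 else 0 := fun i => by
    rw [hy]; exact (coeff_branch _ 2).trans (by simp [v])
  have hylt : ∀ i, ∀ j < 3, PowerSeries.coeff j (y i) = 0 := fun i => coeff_branch_of_lt _
  have row1 : ∀ i : Fin (2 * m + 2),
      ∑ j, x (e.symm (Sum.inl (Sum.inl j))) * ((i.val : ℂ) + 1) ^ (2 * j.val) +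
      (if i.val < m + 2 then 0 else 1) *
        ∑ j, x (e.symm (Sum.inl (Sum.inr j))) * ((i.val : ℂ) + 1) ^ (2 * j.val) = 0 := by
    intro i
    have := congrFun hx (Sum.inl i)
    rw [twoMatrix_mulVec] at this
    simp only [twoCoeff, Sum.elim_inl, Fintype.sum_sum_type, coeff_col_inl (hylt i),
      coeff_col_inr (hylt i), coeff_col_of_lt (hylt i) (Nat.lt_succ_self _), hy3, hy4, yExp, hε,
      mul_zero, Finset.sum_const_zero, add_zero, zero_add, Pi.zero_apply] at this
    rw [Finset.mul_sum]
    refine Eq.trans ?_ this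
    congr 1
    exact Finset.sum_congr rfl fun j _ => by ring
  have L0 : ∀ j, x (e.symm (Sum.inl (Sum.inl j))) = 0 := by
    refine congrFun (eq_zero_of_sum_mul_pow_eq_zero 0
      (k := fun i : Fin (numF (6 * m + 4)) => i.val) Fin.val_injective fun i => ?_)
    have := row1 ⟨i.val, by have := i.2; omega⟩
    rw [if_pos (by have := i.2; simp only; omega)] at this
    simpa using this
  have M1 : ∀ i : Fin (2 * m + 2), m + 2 ≤ i.val →
      ∑ j, x (e.symm (Sum.inl (Sum.inr j))) * ((i.val : ℂ) + 1) ^ (2 * j.val) = 0 := by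
    intro i hi
    have := row1 i
    rw [if_neg (by omega)] at this
    simpa [L0] using this
  have row2 : ∀ i : Fin (2 * m + 2), i.val < m + 2 →
      ∑ j, x (e.symm (Sum.inl (Sum.inr j))) * (2 * (if i.val = 0 then 1 else 0) *
        ((i.val : ℂ) + 1) ^ (2 * j.val)) +
      ∑ j, x (e.symm (Sum.inr (Sum.inl j))) * ((i.val : ℂ) + 1) ^ (1 + 2 * j.val) = 0 := by
    intro i hi
    have h4 : PowerSeries.coeff 4 (y i) = 0 := by rw [hy4, if_pos hi]
    have := congrFun hx (Sum.inr i)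
    rw [twoMatrix_mulVec] at this
    simp only [twoCoeff, Sum.elim_inr, Fintype.sum_sum_type, coeff_col_inl (hylt i),
      coeff_col_inr (hylt i), coeff_succ_col_inr (hylt i) h4, L0, hy3, h4, hy5, yExp, hε, hε',
      mul_zero, zero_mul, Finset.sum_const_zero, add_zero, zero_add, Pi.zero_apply] at this
    exact this
  -- Branches 1, …, m+1 have a₄ = a₅ = 0, so there only the m+1 unknowns of the `monoF` columns of
  -- weight n+1 survive.
  have N0 : ∀ j, x (e.symm (Sum.inr (Sum.inl j))) = 0 := by
    refine congrFun (eq_zero_of_sum_mul_pow_eq_zero 1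
      (k := fun i : Fin (numF (6 * m + 4 + 1)) => i.val + 1)
      (fun i i' h => Fin.ext (by simpa using h)) fun i => ?_)
    have := row2 ⟨i.val + 1, by have := i.2; omega⟩ (by have := i.2; simp only; omega)
    simpa using this
  -- The m+1 unknowns meet m conditions from the last branches at t^n; the missing one comes from
  -- branch 0 at t^(n+1), where a₅ = 1.
  have M0 : ∀ j, x (e.symm (Sum.inl (Sum.inr j))) = 0 := by
    refine congrFun (eq_zero_of_sum_mul_pow_eq_zero 0
      (k := fun i : Fin (numG (6 * m + 4)) => if i.val = 0 then 0 else m + 1 + i.val)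
      (fun i i' h => Fin.ext (by simp only at h; split_ifs at h <;> omega)) fun i => ?_)
    by_cases hi : i.val = 0
    · have := row2 ⟨0, by omega⟩ (by simp)
      simpa [hi, N0, ← Finset.sum_mul] using this
    · have := M1 ⟨m + 1 + i.val, by have := i.2; omega⟩ (by simp only; omega)
      simpa [hi] using this
  have R0 : ∀ j, x (e.symm (Sum.inr (Sum.inr j))) = 0 := by
    refine congrFun (eq_zero_of_sum_mul_pow_eq_zero 1
      (k := fun i : Fin (numG (6 * m + 4 + 1)) => m + 2 + i.val)
      (fun i i' h => Fin.ext (by simpa using h)) fun i => ?_)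
    have hi : m + 2 + i.val < 2 * m + 2 := by have := i.2; omega
    have := congrFun hx (Sum.inr ⟨m + 2 + i.val, hi⟩)
    rw [twoMatrix_mulVec] at this
    simpa [twoCoeff, coeff_col_inr (hylt _), L0, M0, N0, hy3, hy4, yExp, hε'] using this
  funext q
  obtain ⟨c, rfl⟩ := e.symm.surjective q
  rcases c with (c | c) | (c | c)
  · exact L0 c
  · exact M0 c
  · exact N0 c
  · exact R0 c

/-! ### The rank of the jet space for generic coefficients -/

namespace Multigerm

variable {r : ℕ} {φ : Multigerm r}

/-- All determinants of `leadMatrix` for the coefficients of `t³` and `t⁴` are nonzero. -/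
def LeadGeneric (φ : Multigerm r) : Prop :=
  ∀ ε < 2, ∀ s t : ℕ, ∀ h : s + t ≤ r,
    (leadMatrix (fun i => PowerSeries.coeff 3 (φ.y i)) (fun i => PowerSeries.coeff 4 (φ.y i))
      ε h).det ≠ 0

theorem IsPuiseuxBlock.leadMatrix_mulVec (hφ : φ.IsPuiseuxBlock 2 3) {n s t : ℕ}
    (hs : s ≤ numF n) (ht : t ≤ numG n) (h : s + t ≤ r) (x : Fin s ⊕ Fin t → ℂ) (p) :
    (leadMatrix (fun i => PowerSeries.coeff 3 (φ.y i)) (fun i => PowerSeries.coeff 4 (φ.y i))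
      (n % 2) h).mulVec x p = ∑ q, x q * φ.lead n (Sum.map (Fin.castLE hs) (Fin.castLE ht) q)
        (Fin.castLE h (finSumFinEquiv p)) := by
  rw [Matrix.mulVec, dotProduct]
  refine Finset.sum_congr rfl fun q _ => ?_
  rcases q with q | q
  · simp [lead, leadMatrix, coeff_col_inl (hφ.coeff_y _), yExp, mul_comm]
  · simp [lead, leadMatrix, coeff_col_inr (hφ.coeff_y _), yExp, mul_comm]

theorem IsPuiseuxBlock.linearIndependent_lead (hφ : φ.IsPuiseuxBlock 2 3) (hg : φ.LeadGeneric)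
    {n : ℕ} (h : numF n + numG n ≤ r) : LinearIndependent ℂ (φ.lead n) := by
  refine Fintype.linearIndependent_iff.2 fun x hx => ?_
  refine congrFun (Matrix.eq_zero_of_mulVec_eq_zero
    (hg (n % 2) (Nat.mod_lt _ two_pos) _ _ h) ?_)
  funext p
  rw [hφ.leadMatrix_mulVec le_rfl le_rfl h]
  have := congrFun hx (Fin.castLE h (finSumFinEquiv p))
  simp only [Finset.sum_apply, Pi.smul_apply, smul_eq_mul, Pi.zero_apply] at this
  rw [Pi.zero_apply, ← this]
  refine Finset.sum_congr rfl fun q _ => ?_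
  rcases q with q | q <;> rfl

theorem IsPuiseuxBlock.exists_mem_jetSpace (hφ : φ.IsPuiseuxBlock 2 3) (hg : φ.LeadGeneric)
    {n s t : ℕ} (hs : s ≤ numF n) (ht : t ≤ numG n) (h : s + t ≤ r) (b : Fin r → ℂ) :
    ∃ c ∈ φ.jetSpace n, ∀ i : Fin r, i.val < s + t → c i = b i := by
  have hunit := (Matrix.isUnit_iff_isUnit_det _).2
    (isUnit_iff_ne_zero.2 (hg (n % 2) (Nat.mod_lt _ two_pos) _ _ h))
  obtain ⟨x, hx⟩ := Matrix.mulVec_surjective_iff_isUnit.2 hunit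
    fun p => b (Fin.castLE h (finSumFinEquiv p))
  refine ⟨∑ q, x q • φ.lead n (Sum.map (Fin.castLE hs) (Fin.castLE ht) q),
    Submodule.sum_mem _ fun q _ => Submodule.smul_mem _ _ (hφ.lead_mem_jetSpace _ _),
    fun i hi => ?_⟩
  have := congrFun hx (finSumFinEquiv.symm ⟨i.val, hi⟩)
  rw [hφ.leadMatrix_mulVec hs ht h] at this
  simpa using this

/-- If the columns of weight k already number r, the upper bound is trivial; otherwise it rests on
independence in all lower weights. The surjectivity needs neither. -/
theorem IsPuiseuxBlock.jetSpace_rank (hφ : φ.IsPuiseuxBlock 2 3) (hg : φ.LeadGeneric) {k : ℕ}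
    (hk : r ≤ numF k + numG k ∨ ∀ n < k, numF n + numG n ≤ r) :
    Module.finrank ℂ (φ.jetSpace k) ≤ min (numF k + numG k) r ∧
      ∀ b : Fin r → ℂ, ∃ c ∈ φ.jetSpace k, ∀ i : Fin r,
        i.val < min (numF k + numG k) r → c i = b i := by
  constructor
  · have hr : Module.finrank ℂ (φ.jetSpace k) ≤ r := by
      simpa using Submodule.finrank_le (φ.jetSpace k)
    refine le_min ?_ hr
    rcases hk with hk | hk
    · exact hr.trans hk
    · exact hφ.finrank_jetSpace_le fun n hn => hφ.linearIndependent_lead hg (hk n hn)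
  · intro b
    -- Use as many `monoF` columns as fit into r, then fill up with `monoG` columns.
    have h : min (numF k) r + min (numG k) (r - min (numF k) r) = min (numF k + numG k) r := by
      omega
    obtain ⟨c, hc, hcb⟩ := hφ.exists_mem_jetSpace hg (min_le_left (numF k) r)
      (min_le_left (numG k) (r - min (numF k) r)) (by omega) b
    exact ⟨c, hc, fun i hi => hcb i (by omega)⟩

end Multigerm

/-! ### The genericity polynomial and the count of columns -/

/-- The product of all polynomials `leadPoly` for `r` branches. -/
def leadProd (r : ℕ) : MvPolynomial (Fin r × ℕ) ℂ :=
  ∏ ε ∈ Finset.range 2, ∏ s ∈ Finset.range (r + 1), ∏ t ∈ Finset.range (r + 1),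
    if h : s + t ≤ r then leadPoly ε h else 1

/-- One finite product serves all k: a leading matrix depends on the weight only through its parity
ε and the block sizes s, t with s + t ≤ r. -/
theorem leadProd_ne_zero (r : ℕ) : leadProd r ≠ 0 := by
  refine Finset.prod_ne_zero_iff.2 fun ε _ => Finset.prod_ne_zero_iff.2 fun s _ =>
    Finset.prod_ne_zero_iff.2 fun t _ => ?_
  split_ifs with h
  · exact leadPoly_ne_zero ε h
  · exact one_ne_zero

theorem leadGeneric_of_eval_ne_zero {r : ℕ} {φ : Multigerm r}
    (h : MvPolynomial.eval (φ.coeffVector 3) (leadProd r) ≠ 0) : φ.LeadGeneric := by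
  intro ε hε s t hst
  simp only [leadProd, map_prod] at h
  have h1 := Finset.prod_ne_zero_iff.1 h ε (Finset.mem_range.2 hε)
  have h2 := Finset.prod_ne_zero_iff.1 h1 s (Finset.mem_range.2 (by omega))
  have h3 := Finset.prod_ne_zero_iff.1 h2 t (Finset.mem_range.2 (by omega))
  rw [dif_pos hst, eval_leadPoly] at h3
  exact h3

/-- For r = 2m + 2 the weights 6m+4 and 6m+5 have 2m+3 and 2m+1 columns, together 2r, so the
two-weight matrix is square. -/
theorem exists_poly_jetSpace_eq_top {r : ℕ} (hr : Even r) (h4 : 4 ≤ r) :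
    ∃ Q : MvPolynomial (Fin r × ℕ) ℂ, Q ≠ 0 ∧ ∀ φ : Multigerm r, φ.IsPuiseuxBlock 2 3 →
      MvPolynomial.eval (φ.coeffVector 3) Q ≠ 0 → φ.jetSpace (3 * r - 1) = ⊤ := by
  obtain ⟨m, rfl⟩ : ∃ m, r = 2 * m + 2 := by
    obtain ⟨l, hl⟩ := hr
    exact ⟨l - 1, by omega⟩
  have hcard : Fintype.card (Fin (2 * m + 2) ⊕ Fin (2 * m + 2)) = Fintype.card
      ((Fin (numF (6 * m + 4)) ⊕ Fin (numG (6 * m + 4))) ⊕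
      (Fin (numF (6 * m + 4 + 1)) ⊕ Fin (numG (6 * m + 4 + 1)))) := by
    simp only [Fintype.card_sum, Fintype.card_fin]
    unfold numF numG
    split_ifs <;> omega
  refine ⟨twoPoly (6 * m + 4) (Fintype.equivOfCardEq hcard), twoPoly_ne_zero m _ (by omega),
    fun φ hφ h => ?_⟩
  rw [show 3 * (2 * m + 2) - 1 = 6 * m + 4 + 1 by omega]
  refine hφ.jetSpace_succ_eq_top (6 * m + 4) (Fintype.equivOfCardEq hcard) ?_
  rw [eval_twoPoly] at h
  convert h using 3
  funext i
  ext j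
  rcases Nat.lt_or_ge j 3 with hj | hj
  · rw [hφ.coeff_y i j hj, coeff_branch_of_lt _ j hj]
  · obtain ⟨l, rfl⟩ := Nat.exists_eq_add_of_le' hj
    rw [coeff_branch, Multigerm.coeffVector, add_comm]

/-- The count decreases only from weight 6m+4 to 6m+5. For m ≥ 1 it falls from 2m+3 to 2m+1, leaving
just r = 2m+2 in between; for m = 0 it falls from 2 to 1, leaving nothing. -/
theorem numF_add_numG_le {r k n : ℕ} (hr : 2 ≤ r) (h : ¬ (Even r ∧ 4 ≤ r ∧ k = 3 * r - 1))
    (hk : 3 < k) (hlt : numF k + numG k < r) (hn : n < k) : numF n + numG n ≤ r := by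
  have h' : r % 2 = 0 → 4 ≤ r → k ≠ 3 * r - 1 := fun h1 h2 h3 =>
    h ⟨Nat.even_iff.2 h1, h2, h3⟩
  unfold numF numG at *
  have hn2 := Nat.mod_two_eq_zero_or_one n
  have hk2 := Nat.mod_two_eq_zero_or_one k
  split_ifs at * <;> omega

end PlaneCurve

end

/-! ### Assembly of the proposition -/

theorem proposition6p6 (r : ℕ) (hr : 2 ≤ r) :
    ∃ P : MvPolynomial (Fin r × ℕ) ℂ, P ≠ 0 ∧
      ∀ φ : PlaneCurve.Multigerm r, φ.IsPuiseuxBlock 2 3 →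
        φ.valueSemiring = PlaneCurve.semiringSpan (PlaneCurve.gens 2 3 r) →
        MvPolynomial.eval (φ.coeffVector 3) P ≠ 0 →
        (∀ k : ℕ, 3 < k → φ.IsL k (Finset.univ.filter fun i : Fin r => i.val < φ.e k)) ∧
        φ.e 4 = 2 ∧ φ.e 5 = 1 ∧
        (∀ k : ℕ, 6 ≤ k → ¬ (Even r ∧ k = 3 * r - 1) →
          (k % 6 ≠ 4 → φ.e k = min (2 * (k / 6) + 1) r) ∧
          (k % 6 = 4 → φ.e k = min (2 * (k / 6) + 3) r)) ∧
        (Even r → 4 ≤ r →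
          6 * ((r - 2) / 2) + 5 = 3 * r - 1 ∧ φ.e (3 * r - 1) = r) := by
  obtain ⟨Q, hQ0, hQ⟩ : ∃ Q : MvPolynomial (Fin r × ℕ) ℂ, Q ≠ 0 ∧
      ∀ φ : PlaneCurve.Multigerm r, φ.IsPuiseuxBlock 2 3 →
      MvPolynomial.eval (φ.coeffVector 3) Q ≠ 0 → Even r → 4 ≤ r →
        φ.jetSpace (3 * r - 1) = ⊤ := by
    by_cases h : Even r ∧ 4 ≤ r
    · obtain ⟨Q, hQ0, hQ⟩ := PlaneCurve.exists_poly_jetSpace_eq_top h.1 h.2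
      exact ⟨Q, hQ0, fun φ hφ hφQ _ _ => hQ φ hφ hφQ⟩
    -- For r odd or r = 2 there is no exceptional weight and no further condition.
    · exact ⟨1, one_ne_zero, fun φ _ _ h1 h2 => absurd ⟨h1, h2⟩ h⟩
  refine ⟨PlaneCurve.leadProd r * Q, mul_ne_zero (PlaneCurve.leadProd_ne_zero r) hQ0,
    fun φ hφ _ hP => ?_⟩
  rw [map_mul] at hP
  have hg := PlaneCurve.leadGeneric_of_eval_ne_zero (left_ne_zero_of_mul hP)
  have htop := hQ φ hφ (right_ne_zero_of_mul hP)
  have regular : ∀ k, 3 < k → ¬ (Even r ∧ 4 ≤ r ∧ k = 3 * r - 1) →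
      φ.e k = min (PlaneCurve.numF k + PlaneCurve.numG k) r ∧
      φ.IsL k (Finset.univ.filter fun i : Fin r => i.val < φ.e k) := by
    intro k hk h
    obtain ⟨h1, h2⟩ := hφ.jetSpace_rank hg (k := k) (by
      rcases Nat.lt_or_ge (PlaneCurve.numF k + PlaneCurve.numG k) r with hlt | hge
      · exact Or.inr fun n hn => PlaneCurve.numF_add_numG_le hr h hk hlt hn
      · exact Or.inl hge)
    have he := PlaneCurve.Multigerm.e_eq (min_le_right _ _) h1 h2
    exact ⟨he, he ▸ PlaneCurve.Multigerm.isL_filter (min_le_right _ _) h1 h2⟩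
  have exceptional : Even r → 4 ≤ r → φ.e (3 * r - 1) = r ∧ φ.IsL (3 * r - 1)
      (Finset.univ.filter fun i : Fin r => i.val < φ.e (3 * r - 1)) := by
    intro h1 h2
    have hrank : Module.finrank ℂ (φ.jetSpace (3 * r - 1)) ≤ r := by
      simpa using Submodule.finrank_le (φ.jetSpace (3 * r - 1))
    have hs : ∀ b : Fin r → ℂ, ∃ c ∈ φ.jetSpace (3 * r - 1), ∀ i : Fin r, i.val < r →
        c i = b i := fun b => ⟨b, by rw [htop h1 h2]; trivial, fun _ _ => rfl⟩
    have he := PlaneCurve.Multigerm.e_eq le_rfl hrank hs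
    exact ⟨he, by simpa only [he] using PlaneCurve.Multigerm.isL_filter le_rfl hrank hs⟩
  refine ⟨fun k hk => ?_, ?_, ?_, fun k hk h => ?_, fun h1 h2 => ?_⟩
  · by_cases h : Even r ∧ 4 ≤ r ∧ k = 3 * r - 1
    · obtain ⟨h1, h2, rfl⟩ := h
      exact (exceptional h1 h2).2
    · exact (regular k hk h).2
  · rw [(regular 4 (by norm_num) (by omega)).1]
    simpa [PlaneCurve.numF, PlaneCurve.numG] using hr
  · rw [(regular 5 (by norm_num) (by omega)).1]
    simp [PlaneCurve.numF, PlaneCurve.numG]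
    omega
  · rw [(regular k (by omega) fun h' => h ⟨h'.1, h'.2.2⟩).1]
    have : PlaneCurve.numF k + PlaneCurve.numG k = 2 * ((k + 2 - 3 * (k % 2)) / 6) + 1 := by
      unfold PlaneCurve.numF PlaneCurve.numG
      rw [if_neg (by omega), if_neg (by omega)]
      ring
    rw [this]
    exact ⟨fun h => by congr 1; omega, fun h => by congr 1; omega⟩
  · refine ⟨?_, (exceptional h1 h2).1⟩
    obtain ⟨l, hl⟩ := h1
    omega
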